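/- Let $k$ be a nonnegative integer, $\infty$ or $\omega$, and let $\alpha\in[0,1]$. A function is $C^{k,\alpha}$ if it is $C^k$ (analytic for $k=\omega$) and, when $k$ is finite and $\alpha>0$, its $k$th partial derivatives are locally $\alpha$-Hölder continuous (locally Lipschitz when $\alpha=1$); thus $C^{k,0}=C^k$, and $\alpha$ plays no role when $k\in\{\infty,\omega\}$. A convex body in $\mathbb{R}^n$ is a compact convex set with nonempty interior. A convex body $C$ is $C^{k,\alpha}$ if its boundary $\partial C$ is a $C^{k,\alpha}$ submanifold (hypersurface) of $\mathbb{R}^n$, and $C$ is $C^{k,\alpha}$ near $p\in\partial C$ if $\partial C\cap U$ is such a submanifold for some open neighborhood $U$ of $p$. If $C$ is $C^2$ near $p$, let $G_C(p)$ denote the Gaussian curvature of $\partial C$ at $p$, i.e. the product of the eigenvalues of the differential at $p$ of the Gauss map $\nu_C$, which assigns to a boundary point the unit outer normal. Theorem. Let $A$, $B$ be $C^2$ convex bodies in $\mathbb{R}^n$ with Minkowski sum $A+B$, and let $a\in\partial A$, $b\in\partial B$ be such that $a+b\in\partial(A+B)$. Suppose that $A$ is $C^{k,\alpha}$ near $a$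 and $G_A(a)\neq 0$. Then (i) $A+B$ is $C^2$ near $a+b$; (ii) $G_B(b)\neq 0$ if and only if $G_{A+B}(a+b)\neq 0$; (iii) $B$ is $C^{k,\alpha}$ near $b$ if and only if $A+B$ is $C^{k,\alpha}$ near $a+b$. -/

import Mathlib

open scoped NNReal ContDiff Topology

noncomputable section

/-- `f` is of class `C^{k,α}` on the open set `U`, where `k` is a natural number, `∞` or `ω`:
`f` is `C^k` on `U` and, if `k = m` is finite and `α ≠ 0`, the `m`-th derivative of `f` is
locally `α`-Hölder on `U` (locally Lipschitz if `α = 1`). For `α = 0` this is just `C^k`;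
for `k = ∞, ω` the exponent `α` plays no role. -/
def IsCHolderOn {E F : Type*} [NormedAddCommGroup E] [NormedSpace ℝ E]
    [NormedAddCommGroup F] [NormedSpace ℝ F]
    (k : WithTop ℕ∞) (α : ℝ≥0) (f : E → F) (U : Set E) : Prop :=
  ContDiffOn ℝ k f U ∧
    ∀ m : ℕ, k = (m : WithTop ℕ∞) → α ≠ 0 →
      ∀ x ∈ U, ∃ V ∈ 𝓝 x, ∃ c : ℝ≥0, HolderOnWith c α (iteratedFDeriv ℝ m f) V

/-- `S` is a `C^{k,α}` submanifold of codimension one of `ℝⁿ`: each point of `S` lies in the open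
domain of a `C^{k,α}` diffeomorphism `Φ` between open subsets of `ℝⁿ` (both `Φ` and its inverse
are `C^{k,α}`) that takes the part of `S` in that domain onto the part of a linear hyperplane
in the range of `Φ`. -/
def IsCHolderHypersurface {n : ℕ} (k : WithTop ℕ∞) (α : ℝ≥0)
    (S : Set (EuclideanSpace ℝ (Fin n))) : Prop :=
  ∀ p ∈ S, ∃ Φ : OpenPartialHomeomorph (EuclideanSpace ℝ (Fin n)) (EuclideanSpace ℝ (Fin n)),
    p ∈ Φ.source ∧ IsCHolderOn k α Φ Φ.source ∧ IsCHolderOn k α Φ.symm Φ.target ∧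
      ∃ e : EuclideanSpace ℝ (Fin n), e ≠ 0 ∧
        ∀ x ∈ Φ.source, x ∈ S ↔ inner ℝ e (Φ x) = 0

/-- The body `C` is `C^{k,α}`: its boundary is a `C^{k,α}` submanifold of `ℝⁿ`. -/
def ConvexBody.IsCHolder {n : ℕ} (k : WithTop ℕ∞) (α : ℝ≥0)
    (C : ConvexBody (EuclideanSpace ℝ (Fin n))) : Prop :=
  IsCHolderHypersurface k α (frontier (C : Set (EuclideanSpace ℝ (Fin n))))

/-- The body `C` is `C^{k,α}` near the point `p`: the part of its boundary in some open
neighborhood of `p` is a `C^{k,α}` submanifold of `ℝⁿ`. -/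
def ConvexBody.IsCHolderNear {n : ℕ} (k : WithTop ℕ∞) (α : ℝ≥0)
    (C : ConvexBody (EuclideanSpace ℝ (Fin n))) (p : EuclideanSpace ℝ (Fin n)) : Prop :=
  ∃ U : Set (EuclideanSpace ℝ (Fin n)), IsOpen U ∧ p ∈ U ∧
    IsCHolderHypersurface k α (frontier (C : Set (EuclideanSpace ℝ (Fin n))) ∩ U)

/-- `v` is a unit outer normal vector of `C` at `p`. -/
def ConvexBody.IsUnitOuterNormal {n : ℕ} (C : ConvexBody (EuclideanSpace ℝ (Fin n)))
    (p v : EuclideanSpace ℝ (Fin n)) : Prop :=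
  ‖v‖ = 1 ∧ ∀ x ∈ C, inner ℝ v (x - p) ≤ 0

/-- The Gauss map `ν_C`: it sends a boundary point `p` to the unit outer normal at `p`, which
is unique where the boundary is `C^1`. (Only values at boundary points are meaningful.) -/
def ConvexBody.gaussMap {n : ℕ} (C : ConvexBody (EuclideanSpace ℝ (Fin n)))
    (p : EuclideanSpace ℝ (Fin n)) : EuclideanSpace ℝ (Fin n) :=
  Classical.epsilon (C.IsUnitOuterNormal p)

/-- The tangent hyperplane (through the origin) of `∂C` at `p`: the orthogonal complement of the
unit outer normal. It is also the tangent space of the unit sphere at `ν_C(p)`. -/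
def ConvexBody.tangentHyperplane {n : ℕ} (C : ConvexBody (EuclideanSpace ℝ (Fin n)))
    (p : EuclideanSpace ℝ (Fin n)) : Submodule ℝ (EuclideanSpace ℝ (Fin n)) :=
  (Submodule.span ℝ {C.gaussMap p})ᗮ

/-- The differential at `p` of the Gauss map `∂C → S^{n-1}`, as an endomorphism of the tangent
hyperplane: the derivative of `ν_C` along `∂C`, restricted to tangent vectors. Where `∂C` is `C^2`,
the restriction does not depend on the choice made in `fderivWithin`, and its values
are already tangent, so that the orthogonal projection only adjusts the codomain. -/
def ConvexBody.gaussMapDifferential {n : ℕ} (C : ConvexBody (EuclideanSpace ℝ (Fin n)))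
    (p : EuclideanSpace ℝ (Fin n)) : C.tangentHyperplane p →ₗ[ℝ] C.tangentHyperplane p :=
  ((C.tangentHyperplane p).orthogonalProjectionOnto ∘L
    fderivWithin ℝ C.gaussMap (frontier (C : Set (EuclideanSpace ℝ (Fin n)))) p ∘L
      (C.tangentHyperplane p).subtypeL).toLinearMap

/-- The Gaussian curvature `G_C(p)`: the product of the eigenvalues (with multiplicity), i.e. the
determinant, of the differential of the Gauss map at `p`. -/
def ConvexBody.gaussianCurvature {n : ℕ} (C : ConvexBody (EuclideanSpace ℝ (Fin n)))
    (p : EuclideanSpace ℝ (Fin n)) : ℝ :=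
  LinearMap.det (C.gaussMapDifferential p)

end

/-! Let `u` be a unit outer normal of `A + B` at `a + b`; it is also an outer normal of `A` at `a`
and of `B` at `b`. Over the common hyperplane `uᗮ` the boundaries are graphs of `-f` and `-g`, with
`f`, `g` of class `C^2`, vanishing to first order at 0, and with positive semidefinite Hessians `H`
and `K` there; nonzero curvature of `A` makes `H` invertible. The boundary of `A + B` is then the
graph of `-h`, where `h(z) = f(z - Y z) + g(Y z)` and `Y` splits `z` so that `Df(z - Y z) = Dg(Y
z)`, that is, so that the two boundary points share an outer normal (`ConvexBody.IsGraphAt.add`).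
With `φ` the local inverse of `Df`, `Y` is the local inverse of `Z = id + φ ∘ Dg`, whose derivative
`1 + H⁻¹K` is invertible because `H` is definite and `K` semidefinite. Everything follows from `Dh =
Dg ∘ Y` (`exists_splitting`). It gives `h` one more derivative than `Y` has, and `D²h(0) = K (1 +
H⁻¹K)⁻¹`, which is injective exactly when `K` is. Conversely `Y = id - φ ∘ Dh`, so regularity of `f`
and `h` passes to `Y`, then to `Z`, then to `Dg = Dh ∘ Z`. The translation to bodies rests on
`isCHolderNear_iff` and `gaussianCurvature_ne_zero_iff`; the analysis rests on closure of `C^{k,α}`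
maps under composition and local inversion. -/

open Filter

/-! ### Calculus of `C^{k,α}` maps at a point. -/

section Holder

variable {E F G : Type} [NormedAddCommGroup E] [NormedSpace ℝ E]
  [NormedAddCommGroup F] [NormedSpace ℝ F] [NormedAddCommGroup G] [NormedSpace ℝ G]
  {α : ℝ≥0} {f : E → F} {g : F → G} {x : E}

/-- `f` is `α`-Hölder on some neighborhood of `x`. -/
def LocHolderAt {X Y : Type} [PseudoEMetricSpace X] [PseudoEMetricSpace Y]
    (α : ℝ≥0) (f : X → Y) (x : X) : Prop :=
  ∃ V ∈ 𝓝 x, ∃ c : ℝ≥0, HolderOnWith c α f V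

namespace LocHolderAt

theorem congr {X Y : Type} [PseudoEMetricSpace X] [PseudoEMetricSpace Y] {f g : X → Y} {x : X}
    (hf : LocHolderAt α f x) (h : f =ᶠ[𝓝 x] g) : LocHolderAt α g x := by
  obtain ⟨V, hV, c, hc⟩ := hf
  refine ⟨V ∩ {y | f y = g y}, inter_mem hV h, c, fun y hy z hz => ?_⟩
  rw [← hy.2, ← hz.2]
  exact hc y hy.1 z hz.1

theorem lipschitz_comp {X Y Z : Type} [PseudoEMetricSpace X] [PseudoEMetricSpace Y]
    [PseudoEMetricSpace Z] {g : Y → Z} {f : X → Y} {x : X}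
    (hg : ∃ K : ℝ≥0, ∃ t ∈ 𝓝 (f x), LipschitzOnWith K g t)
    (hf : LocHolderAt α f x) (hfc : ContinuousAt f x) : LocHolderAt α (g ∘ f) x := by
  obtain ⟨K, t, ht, hK⟩ := hg
  obtain ⟨V, hV, c, hc⟩ := hf
  have h := (holderOnWith_one.2 hK).comp (hc.mono Set.inter_subset_left)
    (fun y (hy : y ∈ V ∩ f ⁻¹' t) => hy.2)
  exact ⟨V ∩ f ⁻¹' t, inter_mem hV (hfc ht), _, one_mul α ▸ h⟩

theorem comp_lipschitz {X Y Z : Type} [PseudoEMetricSpace X] [PseudoEMetricSpace Y]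
    [PseudoEMetricSpace Z] {g : Y → Z} {f : X → Y} {x : X}
    (hg : LocHolderAt α g (f x)) (hf : ∃ K : ℝ≥0, ∃ t ∈ 𝓝 x, LipschitzOnWith K f t)
    (hfc : ContinuousAt f x) : LocHolderAt α (g ∘ f) x := by
  obtain ⟨K, t, ht, hK⟩ := hf
  obtain ⟨V, hV, c, hc⟩ := hg
  have h := hc.comp ((holderOnWith_one.2 hK).mono Set.inter_subset_left)
    (fun y (hy : y ∈ t ∩ f ⁻¹' V) => hy.2)
  exact ⟨t ∩ f ⁻¹' V, inter_mem ht (hfc hV), _, by rwa [mul_one] at h⟩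

theorem add {X F : Type} [PseudoEMetricSpace X] [SeminormedAddCommGroup F] {f g : X → F} {x : X}
    (hf : LocHolderAt α f x) (hg : LocHolderAt α g x) : LocHolderAt α (f + g) x := by
  obtain ⟨V, hV, c, hc⟩ := hf
  obtain ⟨W, hW, d, hd⟩ := hg
  refine ⟨V ∩ W, inter_mem hV hW, c + d, fun y hy z hz => ?_⟩
  calc edist (f y + g y) (f z + g z) ≤ edist (f y) (f z) + edist (g y) (g z) :=
        edist_add_add_le _ _ _ _
    _ ≤ c * edist y z ^ (α : ℝ) + d * edist y z ^ (α : ℝ) :=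
        add_le_add (hc y hy.1 z hz.1) (hd y hy.2 z hz.2)
    _ = _ := by push_cast; rw [add_mul]

theorem of_lipschitz {X Y : Type} [PseudoMetricSpace X] [PseudoEMetricSpace Y] {f : X → Y} {x : X}
    (hα : α ≤ 1) (hf : ∃ K : ℝ≥0, ∃ t ∈ 𝓝 x, LipschitzOnWith K f t) : LocHolderAt α f x := by
  obtain ⟨K, t, ht, hK⟩ := hf
  -- Radius 1/2 keeps mutual distances `d` at most 1, where `d ≤ d ^ α` for `α ≤ 1`.
  refine ⟨t ∩ Metric.ball x (1 / 2), inter_mem ht (Metric.ball_mem_nhds _ (by norm_num)), K,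
    fun y hy z hz => (hK hy.1 hz.1).trans ?_⟩
  have h1 : edist y z ≤ 1 := by
    rw [edist_dist, ENNReal.ofReal_le_one]
    have h2 := dist_triangle_right y z x
    have h3 := Metric.mem_ball.1 hy.2
    have h4 := Metric.mem_ball.1 hz.2
    linarith
  gcongr
  simpa using ENNReal.rpow_le_rpow_of_exponent_ge h1 (show (α : ℝ) ≤ 1 from mod_cast hα)

end LocHolderAt

/-- `f` is of class `C^m` at `x`, with `m`-th derivative `α`-Hölder near `x`. -/
def ContDiffHolderAt (m : ℕ) (α : ℝ≥0) (f : E → F) (x : E) : Prop :=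
  ContDiffAt ℝ m f x ∧ LocHolderAt α (iteratedFDeriv ℝ m f) x

namespace ContDiffHolderAt

variable {m : ℕ}

theorem congr {f g : E → F} (hf : ContDiffHolderAt m α f x) (h : f =ᶠ[𝓝 x] g) :
    ContDiffHolderAt m α g x :=
  ⟨hf.1.congr_of_eventuallyEq h.symm, hf.2.congr (h.iteratedFDeriv ℝ m)⟩

theorem zero_iff : ContDiffHolderAt 0 α f x ↔ ContDiffAt ℝ 0 f x ∧ LocHolderAt α f x := by
  simp only [ContDiffHolderAt, LocHolderAt, HolderOnWith, iteratedFDeriv_zero_eq_comp,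
    Function.comp_apply, LinearIsometryEquiv.edist_map]
  rfl

/-- Currying is an isometry, so Hölder bounds pass between the two forms of the top derivative. This
drives the inductions on `m`. -/
theorem succ_iff : ContDiffHolderAt (m + 1) α f x ↔
    (∀ᶠ y in 𝓝 x, DifferentiableAt ℝ f y) ∧ ContDiffHolderAt m α (fderiv ℝ f) x := by
  have key : LocHolderAt α (iteratedFDeriv ℝ (m + 1) f) x ↔
      LocHolderAt α (iteratedFDeriv ℝ m (fderiv ℝ f)) x := by
    simp only [LocHolderAt, HolderOnWith, iteratedFDeriv_succ_eq_comp_right,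
      Function.comp_apply, LinearIsometryEquiv.edist_map]
  rw [ContDiffHolderAt, key, ContDiffHolderAt, ← and_assoc]
  refine and_congr_left fun _ => ⟨fun h => ⟨?_, h.fderiv_right (by push_cast; rfl)⟩, fun h => ?_⟩
  · have h1 : ContDiffAt ℝ 1 f x := h.of_le (by push_cast; exact le_add_self)
    filter_upwards [h1.eventually (by simp)] with y hy using hy.differentiableAt one_ne_zero
  · push_cast
    exact contDiffAt_succ_iff_hasFDerivAt.2
      ⟨_, ⟨_, h.1, fun y hy => DifferentiableAt.hasFDerivAt hy⟩, h.2⟩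

theorem of_contDiffAt (hα : α ≤ 1) (hf : ContDiffAt ℝ (m + 1 : ℕ) f x) :
    ContDiffHolderAt m α f x := by
  refine ⟨hf.of_le (by push_cast; exact le_self_add), .of_lipschitz hα ?_⟩
  refine ContDiffAt.exists_lipschitzOnWith (𝕂 := ℝ) (hf.iteratedFDeriv_right ?_)
  push_cast
  rw [add_comm]

theorem pred (hα : α ≤ 1) (hf : ContDiffHolderAt (m + 1) α f x) : ContDiffHolderAt m α f x :=
  of_contDiffAt hα hf.1

theorem clm_comp (L : F →L[ℝ] G) (hf : ContDiffHolderAt m α f x) :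
    ContDiffHolderAt m α (fun y => L (f y)) x := by
  refine ⟨L.contDiff.contDiffAt.comp x hf.1, ?_⟩
  have h := LocHolderAt.lipschitz_comp
    (g := ContinuousLinearMap.compContinuousMultilinearMapL ℝ (fun _ : Fin m => E) F G L)
    ⟨_, Set.univ, univ_mem, (ContinuousLinearMap.lipschitz _).lipschitzOnWith⟩ hf.2
    (hf.1.continuousAt_iteratedFDeriv le_rfl)
  refine h.congr ?_
  filter_upwards [hf.1.eventually (by simp)] with y hy
  exact (L.iteratedFDeriv_comp_left hy le_rfl).symm

theorem add {f g : E → F} (hf : ContDiffHolderAt m α f x) (hg : ContDiffHolderAt m α g x) :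
    ContDiffHolderAt m α (fun y => f y + g y) x := by
  refine ⟨hf.1.add hg.1, (hf.2.add hg.2).congr ?_⟩
  filter_upwards [hf.1.eventually (by simp), hg.1.eventually (by simp)] with y h1 h2
  exact (iteratedFDeriv_add_apply h1 h2).symm

theorem prodMk {g : E → G} (hf : ContDiffHolderAt m α f x) (hg : ContDiffHolderAt m α g x) :
    ContDiffHolderAt m α (fun y => (f y, g y)) x := by
  simpa using (hf.clm_comp (ContinuousLinearMap.inl ℝ F G)).add
    (hg.clm_comp (ContinuousLinearMap.inr ℝ F G))

end ContDiffHolderAt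

theorem fderiv_comp_eventuallyEq (hg : ∀ᶠ y in 𝓝 (f x), DifferentiableAt ℝ g y)
    (hf : ∀ᶠ y in 𝓝 x, DifferentiableAt ℝ f y) :
    (fun y => (fun q : (F →L[ℝ] G) × (E →L[ℝ] F) => q.1.comp q.2) (fderiv ℝ g (f y), fderiv ℝ f y))
      =ᶠ[𝓝 x] fderiv ℝ (g ∘ f) := by
  filter_upwards [hf.self_of_nhds.continuousAt.eventually hg, hf] with y h1 h2
  exact (fderiv_comp y h1 h2).symm

theorem ContDiffAt.eventually_differentiableAt {n : WithTop ℕ∞} (hf : ContDiffAt ℝ n f x)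
    (hn : 1 ≤ n) : ∀ᶠ y in 𝓝 x, DifferentiableAt ℝ f y := by
  filter_upwards [(hf.of_le hn).eventually (by simp)] with y hy using
    hy.differentiableAt one_ne_zero

namespace ContDiffHolderAt

/-- The smooth case comes first because the chain rule writes `D(g ∘ f)` as the smooth bilinear
composition applied to a pair of less regular maps. The spaces are quantified inside since the
induction replaces them by operator spaces. -/
theorem smooth_comp {m : ℕ} : ∀ {E F G : Type} [NormedAddCommGroup E] [NormedSpace ℝ E]
    [NormedAddCommGroup F] [NormedSpace ℝ F] [NormedAddCommGroup G] [NormedSpace ℝ G]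
    {f : E → F} {g : F → G} {x : E}, α ≤ 1 → ContDiffAt ℝ ∞ g (f x) → ContDiffHolderAt m α f x →
    ContDiffHolderAt m α (g ∘ f) x := by
  induction m with
  | zero =>
    intro E F G _ _ _ _ _ _ f g x _ hg hf
    rw [zero_iff] at hf ⊢
    exact ⟨(hg.of_le (by simp)).comp x hf.1, hf.2.lipschitz_comp
      (ContDiffAt.exists_lipschitzOnWith (𝕂 := ℝ) (hg.of_le (by norm_cast)))
      hf.1.continuousAt⟩
  | succ m ih =>
    intro E F G _ _ _ _ _ _ f g x hα hg hf
    have hfm := hf.pred hα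
    rw [succ_iff] at hf ⊢
    have hg1 := hg.eventually_differentiableAt (by norm_cast)
    refine ⟨?_, ?_⟩
    · filter_upwards [hf.1.self_of_nhds.continuousAt.eventually hg1, hf.1] with y h1 h2
      exact h1.comp y h2
    · have h1 : ContDiffHolderAt m α (fun y => fderiv ℝ g (f y)) x :=
        ih hα (hg.fderiv_right (by norm_cast)) hfm
      refine ContDiffHolderAt.congr ?_ (fderiv_comp_eventuallyEq hg1 hf.1)
      exact ih (g := fun q : (F →L[ℝ] G) × (E →L[ℝ] F) => q.1.comp q.2) hα
        isBoundedBilinearMap_comp.contDiff.contDiffAt (h1.prodMk hf.2)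

/-- The inner map must be `C^1` even for `m = 0`: composing two merely `α`-Hölder maps would only
give exponent `α²`. -/
theorem comp {m : ℕ} : ∀ {E F G : Type} [NormedAddCommGroup E] [NormedSpace ℝ E]
    [NormedAddCommGroup F] [NormedSpace ℝ F] [NormedAddCommGroup G] [NormedSpace ℝ G]
    {f : E → F} {g : F → G} {x : E}, α ≤ 1 → ContDiffHolderAt m α g (f x) →
    ContDiffHolderAt m α f x → ContDiffAt ℝ 1 f x → ContDiffHolderAt m α (g ∘ f) x := by
  induction m with
  | zero =>
    intro E F G _ _ _ _ _ _ f g x _ hg hf hf1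
    rw [zero_iff] at hg hf ⊢
    exact ⟨hg.1.comp x hf.1, hg.2.comp_lipschitz
      (ContDiffAt.exists_lipschitzOnWith (𝕂 := ℝ) hf1) hf.1.continuousAt⟩
  | succ m ih =>
    intro E F G _ _ _ _ _ _ f g x hα hg hf hf1
    have hfm := hf.pred hα
    rw [succ_iff] at hf hg ⊢
    refine ⟨?_, ?_⟩
    · filter_upwards [hf.1.self_of_nhds.continuousAt.eventually hg.1, hf.1] with y h1 h2
      exact h1.comp y h2
    · have h1 : ContDiffHolderAt m α (fun y => fderiv ℝ g (f y)) x := ih hα hg.2 hfm hf1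
      refine ContDiffHolderAt.congr ?_ (fderiv_comp_eventuallyEq hg.1 hf.1)
      exact smooth_comp (g := fun q : (F →L[ℝ] G) × (E →L[ℝ] F) => q.1.comp q.2) hα
        isBoundedBilinearMap_comp.contDiff.contDiffAt (h1.prodMk hf.2)

end ContDiffHolderAt

/-- Pointwise version of `IsCHolderOn`. -/
def CHolderAt (k : WithTop ℕ∞) (α : ℝ≥0) (f : E → F) (x : E) : Prop :=
  ContDiffAt ℝ k f x ∧ ∀ m : ℕ, k = (m : WithTop ℕ∞) → α ≠ 0 → ContDiffHolderAt m α f x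

/-- `f` is of class `C^{k,α}` on a neighborhood of `x`. -/
def CHolderNear (k : WithTop ℕ∞) (α : ℝ≥0) (f : E → F) (x : E) : Prop :=
  ∀ᶠ y in 𝓝 x, CHolderAt k α f y

theorem isCHolderOn_iff {k : WithTop ℕ∞} {U : Set E} (hU : IsOpen U) :
    IsCHolderOn k α f U ↔ ∀ x ∈ U, CHolderAt k α f x := by
  constructor
  · rintro ⟨h1, h2⟩ x hx
    have h3 := h1.contDiffAt (hU.mem_nhds hx)
    exact ⟨h3, fun m hm hα => ⟨hm ▸ h3, h2 m hm hα x hx⟩⟩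
  · intro h
    exact ⟨fun x hx => (h x hx).1.contDiffWithinAt,
      fun m hm hα x hx => ((h x hx).2 m hm hα).2⟩

theorem IsCHolderOn.mono {k : WithTop ℕ∞} {U V : Set E} (h : IsCHolderOn k α f U) (hV : V ⊆ U) :
    IsCHolderOn k α f V :=
  ⟨h.1.mono hV, fun m hm hα x hx => h.2 m hm hα x (hV hx)⟩

namespace CHolderAt

variable {k j : WithTop ℕ∞}

theorem of_contDiffAt_succ (hα : α ≤ 1) (hf : ContDiffAt ℝ (k + 1) f x) : CHolderAt k α f x := by
  refine ⟨hf.of_le le_self_add, ?_⟩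
  rintro m rfl _
  exact .of_contDiffAt hα (by exact_mod_cast hf)

theorem congr {f g : E → F} (hf : CHolderAt k α f x) (h : f =ᶠ[𝓝 x] g) : CHolderAt k α g x :=
  ⟨hf.1.congr_of_eventuallyEq h.symm, fun m hm h0 => (hf.2 m hm h0).congr h⟩

theorem comp (hα : α ≤ 1) (hg : CHolderAt k α g (f x)) (hf : CHolderAt k α f x)
    (hf1 : ContDiffAt ℝ 1 f x) : CHolderAt k α (g ∘ f) x :=
  ⟨hg.1.comp x hf.1, fun m hm h0 => (hg.2 m hm h0).comp hα (hf.2 m hm h0) hf1⟩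

theorem of_contDiff_top (hα : α ≤ 1) (hf : ContDiff ℝ ω f) : CHolderAt k α f x :=
  of_contDiffAt_succ hα (hf.contDiffAt.of_le le_top)

theorem fderiv (hf : CHolderAt (j + 1) α f x) : CHolderAt j α (fderiv ℝ f) x := by
  refine ⟨hf.1.fderiv_right le_rfl, ?_⟩
  rintro m rfl h0
  exact (ContDiffHolderAt.succ_iff.1 (hf.2 (m + 1) (by push_cast; rfl) h0)).2

theorem of_fderiv (hfd : ∀ᶠ y in 𝓝 x, DifferentiableAt ℝ f y) (hf : ContDiffAt ℝ j f x)
    (hf' : CHolderAt j α (_root_.fderiv ℝ f) x) : CHolderAt (j + 1) α f x := by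
  have key : ∀ i : ℕ, j + 1 = (i : WithTop ℕ∞) → ∃ m : ℕ, i = m + 1 ∧ j = m := by
    intro i hi
    match j, hi with
    | ⊤, hi => exact absurd hi (by simp)
    | ((⊤ : ℕ∞) : WithTop ℕ∞), hi =>
      exact absurd (show (∞ : WithTop ℕ∞) = ((i : ℕ∞) : WithTop ℕ∞) from hi)
        (WithTop.coe_injective.ne (ENat.top_ne_natCast i))
    | ((m : ℕ) : WithTop ℕ∞), hi => exact ⟨m, by exact_mod_cast hi.symm, rfl⟩
  refine ⟨?_, ?_⟩
  -- For `j = ∞` or `ω`, `j + 1 = j` and there is nothing to gain; only finite `j` uses the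
  -- derivative.
  · match j, hf, hf' with
    | ⊤, hf, _ => simpa using hf
    | ((⊤ : ℕ∞) : WithTop ℕ∞), hf, _ => exact hf
    | ((m : ℕ) : WithTop ℕ∞), _, hf' =>
      exact contDiffAt_succ_iff_hasFDerivAt.2
        ⟨_, ⟨_, hfd, fun y hy => DifferentiableAt.hasFDerivAt hy⟩, hf'.1⟩
  · intro i hi h0
    obtain ⟨m, rfl, rfl⟩ := key i hi
    exact ContDiffHolderAt.succ_iff.2 ⟨hfd, hf'.2 m rfl h0⟩

/-- The derivative of the inverse is operator inversion, smooth at an invertible operator, applied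
to `De ∘ e⁻¹`; so it inherits the Hölder bound of `De`. -/
theorem symm [CompleteSpace E] (hα : α ≤ 1) (hk : 1 ≤ k) (e : OpenPartialHomeomorph E F)
    {f' : E ≃L[ℝ] F} {a : F} (ha : a ∈ e.target) (hf' : HasFDerivAt e (f' : E →L[ℝ] F) (e.symm a))
    (he : CHolderAt k α e (e.symm a)) : CHolderAt k α e.symm a := by
  have hs := e.contDiffAt_symm ha hf' he.1
  refine ⟨hs, ?_⟩
  rintro m rfl h0
  obtain ⟨m, rfl⟩ : ∃ i, m = i + 1 := Nat.exists_eq_add_of_le' (by exact_mod_cast hk)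
  have he2 := ContDiffHolderAt.succ_iff.1 (he.2 _ rfl h0)
  have hes : ContDiffAt ℝ 1 e.symm a := hs.of_le hk
  have hd := hes.eventually_differentiableAt le_rfl
  refine ContDiffHolderAt.succ_iff.2 ⟨hd, ?_⟩
  have h1 : ContDiffHolderAt m α (fun y => _root_.fderiv ℝ e (e.symm y)) a :=
    he2.2.comp hα (.of_contDiffAt hα hs) hes
  have h2 : ContDiffHolderAt m α
      (ContinuousLinearMap.inverse ∘ fun y => _root_.fderiv ℝ e (e.symm y)) a := by
    refine ContDiffHolderAt.smooth_comp hα ?_ h1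
    rw [hf'.fderiv]
    exact contDiffAt_map_inverse f'
  refine h2.congr ?_
  filter_upwards [hd, hes.continuousAt.eventually he2.1, e.open_target.mem_nhds ha] with y h3 h4 h5
  have h6 : (_root_.fderiv ℝ e (e.symm y)).comp (_root_.fderiv ℝ e.symm y)
      = ContinuousLinearMap.id ℝ F := by
    rw [← fderiv_comp y h4 h3, ← fderiv_id (x := y)]
    refine EventuallyEq.fderiv_eq ?_
    filter_upwards [e.open_target.mem_nhds h5] with z hz using e.right_inv hz
  have h7 : (_root_.fderiv ℝ e.symm y).comp (_root_.fderiv ℝ e (e.symm y))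
      = ContinuousLinearMap.id ℝ E := by
    have h3' : DifferentiableAt ℝ e.symm (e (e.symm y)) := by rwa [e.right_inv h5]
    have h8 := fderiv_comp (e.symm y) h3' h4
    rw [e.right_inv h5] at h8
    rw [← h8, ← fderiv_id (x := e.symm y)]
    refine EventuallyEq.fderiv_eq ?_
    filter_upwards [e.open_source.mem_nhds (e.map_target h5)] with z hz using e.left_inv hz
  exact ContinuousLinearMap.inverse_eq h6 h7

end CHolderAt

end Holder

/-! ### `C^{k,α}` regularity on a neighborhood, and the inverse function theorem. -/

section Near

variable {E F G : Type} [NormedAddCommGroup E] [NormedSpace ℝ E]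
  [NormedAddCommGroup F] [NormedSpace ℝ F] [NormedAddCommGroup G] [NormedSpace ℝ G]
  {α : ℝ≥0} {f : E → F} {g : F → G} {x : E} {k j : WithTop ℕ∞}

theorem CHolderAt.clm_comp (L : F →L[ℝ] G) (hf : CHolderAt k α f x) :
    CHolderAt k α (fun y => L (f y)) x :=
  ⟨L.contDiff.contDiffAt.comp x hf.1, fun m hm h0 => (hf.2 m hm h0).clm_comp L⟩

theorem CHolderAt.add {f g : E → F} (hf : CHolderAt k α f x) (hg : CHolderAt k α g x) :
    CHolderAt k α (fun y => f y + g y) x :=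
  ⟨hf.1.add hg.1, fun m hm h0 => (hf.2 m hm h0).add (hg.2 m hm h0)⟩

namespace CHolderNear

theorem contDiffAt (hf : CHolderNear k α f x) : ContDiffAt ℝ k f x := hf.self_of_nhds.1

theorem congr {f g : E → F} (hf : CHolderNear k α f x) (h : f =ᶠ[𝓝 x] g) :
    CHolderNear k α g x := by
  filter_upwards [hf, h.eventuallyEq_nhds] with y h1 h2 using h1.congr h2

theorem differentiableAt (hf : CHolderNear k α f x) (hk : 1 ≤ k) :
    ∀ᶠ y in 𝓝 x, DifferentiableAt ℝ f y :=
  hf.contDiffAt.eventually_differentiableAt hk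

theorem comp (hα : α ≤ 1) (hk : 1 ≤ k) (hg : CHolderNear k α g (f x))
    (hf : CHolderNear k α f x) : CHolderNear k α (g ∘ f) x := by
  filter_upwards [hf.contDiffAt.continuousAt.eventually hg, hf] with y h1 h2 
    using h1.comp hα h2 (h2.1.of_le hk)

theorem clm_comp (L : F →L[ℝ] G) (hf : CHolderNear k α f x) :
    CHolderNear k α (fun y => L (f y)) x := by
  filter_upwards [hf] with y hy using hy.clm_comp L

theorem add {f g : E → F} (hf : CHolderNear k α f x) (hg : CHolderNear k α g x) :
    CHolderNear k α (fun y => f y + g y) x := by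
  filter_upwards [hf, hg] with y h1 h2 using h1.add h2

theorem sub {f g : E → F} (hf : CHolderNear k α f x) (hg : CHolderNear k α g x) :
    CHolderNear k α (fun y => f y - g y) x := by
  simpa [sub_eq_add_neg] using hf.add (hg.clm_comp (-ContinuousLinearMap.id ℝ F))

theorem of_contDiff (hα : α ≤ 1) (hf : ContDiff ℝ ω f) : CHolderNear k α f x :=
  .of_forall fun _ => .of_contDiff_top hα hf

theorem comp_contDiff (hα : α ≤ 1) (hg : CHolderNear k α g (f x)) (hf : ContDiff ℝ ω f) :
    CHolderNear k α (g ∘ f) x := by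
  filter_upwards [hf.continuous.continuousAt.eventually hg] with y h1
    using h1.comp hα (.of_contDiff_top hα hf) (hf.contDiffAt.of_le le_top)

theorem of_contDiffAt_two (hα : α ≤ 1) (hk : k ≤ 1) (hf : ContDiffAt ℝ 2 f x) :
    CHolderNear k α f x := by
  filter_upwards [hf.eventually (by simp)] with y hy
  exact .of_contDiffAt_succ hα (hy.of_le ((add_le_add_left hk 1).trans_eq one_add_one_eq_two))

/-- `k = ∞` is excluded: smoothness at a point in the sense of `ContDiffAt` gives every finite order
nearby, but on neighborhoods that may shrink with the order. -/
theorem of_contDiffAt_of_ne (hk : k ≠ ∞) (hf : ContDiffAt ℝ k f x) : CHolderNear k 0 f x := by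
  filter_upwards [hf.eventually hk] with y hy using ⟨hy, fun _ _ h => absurd rfl h⟩

theorem fderiv (hf : CHolderNear (j + 1) α f x) : CHolderNear j α (fderiv ℝ f) x := by
  filter_upwards [hf] with y hy using hy.fderiv

theorem of_succ (hα : α ≤ 1) (hf : CHolderNear (j + 1) α f x) : CHolderNear j α f x := by
  filter_upwards [hf] with y hy using .of_contDiffAt_succ hα hy.1

theorem of_fderiv (hj : 1 ≤ j) (hf : CHolderNear j α f x)
    (hf' : CHolderNear j α (_root_.fderiv ℝ f) x) : CHolderNear (j + 1) α f x := by
  filter_upwards [hf, hf', (hf.differentiableAt hj).eventually_nhds] with y h1 h2 h3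
    using .of_fderiv h3 h1.1 h2

theorem exists_inverse [CompleteSpace E] (hα : α ≤ 1) (hk : 1 ≤ k) (hf : CHolderNear k α f x)
    {f' : E ≃L[ℝ] F} (hf' : HasFDerivAt f (f' : E →L[ℝ] F) x) :
    ∃ g : F → E, g (f x) = x ∧ CHolderNear k α g (f x) ∧
      HasFDerivAt g (f'.symm : F →L[ℝ] E) (f x) ∧
      (∀ᶠ y in 𝓝 x, g (f y) = y) ∧ ∀ᶠ z in 𝓝 (f x), f (g z) = z := by
  have hk0 : k ≠ 0 := (zero_lt_one.trans_le hk).ne'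
  set e := hf.contDiffAt.toOpenPartialHomeomorph f hf' hk0
  have hef : (e : E → F) = f := ContDiffAt.toOpenPartialHomeomorph_coe _ _ _
  have hxs : x ∈ e.source := ContDiffAt.mem_toOpenPartialHomeomorph_source _ _ _
  have hfx : f x ∈ e.target := hef ▸ e.map_source hxs
  have hgx : e.symm (f x) = x := by rw [← hef]; exact e.left_inv hxs
  have hcs : ContinuousAt e.symm (f x) := e.symm.continuousAt hfx
  refine ⟨e.symm, hgx, ?_, ?_, ?_, ?_⟩
  -- Invertible operators form an open set, so the pointwise result applies at all nearby points.
  · have h1 : ∀ᶠ y in 𝓝 x, _root_.fderiv ℝ f y ∈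
        Set.range ((↑) : (E ≃L[ℝ] F) → E →L[ℝ] F) := by
      refine (hf.contDiffAt.continuousAt_fderiv hk0).eventually ?_
      rw [hf'.fderiv]
      exact ContinuousLinearEquiv.nhds f'
    have h2 := (hf.and ((hf.differentiableAt hk).and h1))
    rw [← hgx] at h2
    filter_upwards [hcs.eventually h2, e.open_target.mem_nhds hfx] with z ⟨h3, h4, f'', h5⟩ h6
    refine CHolderAt.symm hα hk e (f' := f'') h6 ?_ (hef ▸ h3)
    rw [h5, hef]
    exact h4.hasFDerivAt
  · refine e.hasFDerivAt_symm hfx ?_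
    rwa [hgx, hef]
  · filter_upwards [e.open_source.mem_nhds hxs] with y hy
    rw [← hef]; exact e.left_inv hy
  · filter_upwards [e.open_target.mem_nhds hfx] with z hz
    rw [← hef]; exact e.right_inv hz

/-- A continuous local right inverse agrees with the one from the inverse function theorem. Thus an
inverse fixed once can be shown regular in every class `C^{k,α}` afterwards. -/
theorem of_inverse [CompleteSpace E] (hα : α ≤ 1) (hk : 1 ≤ k) (hf : CHolderNear k α f x)
    {f' : E ≃L[ℝ] F} (hf' : HasFDerivAt f (f' : E →L[ℝ] F) x) {g : F → E} (hgx : g (f x) = x)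
    (hg : ContinuousAt g (f x)) (hfg : ∀ᶠ z in 𝓝 (f x), f (g z) = z) :
    CHolderNear k α g (f x) := by
  obtain ⟨g', -, h1, -, h2, -⟩ := hf.exists_inverse hα hk hf'
  refine h1.congr ?_
  rw [← hgx] at h2
  filter_upwards [hfg, hg.eventually h2] with z h3 h4
  rwa [h3] at h4

end CHolderNear

theorem exists_eq_add_one_of_two_le (hk : 2 ≤ k) : ∃ j : WithTop ℕ∞, k = j + 1 ∧ 1 ≤ j := by
  match k, hk with
  | ⊤, _ => exact ⟨⊤, rfl, le_top⟩
  | ((⊤ : ℕ∞) : WithTop ℕ∞), _ => exact ⟨∞, rfl, by norm_cast⟩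
  | ((m : ℕ) : WithTop ℕ∞), hk =>
    obtain ⟨i, rfl⟩ := Nat.exists_eq_add_of_le' (show 2 ≤ m by exact_mod_cast hk)
    exact ⟨(i + 1 : ℕ), by push_cast; rw [add_assoc, one_add_one_eq_two],
      by exact_mod_cast Nat.le_add_left 1 i⟩

end Near

/-! ### Infimal convolution through matched gradients. -/

section InfConvolution

variable {V : Type} [NormedAddCommGroup V] [NormedSpace ℝ V]

/-- The Cauchy–Schwarz argument for semidefinite forms: perturbing `v` along `w` would make the form
negative. -/
theorem eq_zero_of_apply_self_eq_zero {A : V →L[ℝ] V →L[ℝ] ℝ} (hs : ∀ v w, A v w = A w v)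
    (hp : ∀ v, 0 ≤ A v v) {v : V} (hv : A v v = 0) : A v = 0 := by
  ext w
  by_contra hne
  replace hne : A v w ≠ 0 := hne
  -- The `+ 1` keeps the denominator positive when `A w w = 0`.
  have h1 := hp (v + (-(A v w) / (A w w + 1)) • w)
  have h2 := hp w
  simp only [map_add, map_smul, add_apply, smul_apply, smul_eq_mul, hv, hs w v] at h1
  have h3 : 0 < A v w ^ 2 := by positivity
  have h4 : 0 + -(A v w) / (A w w + 1) * A v w + -(A v w) / (A w w + 1) *
      (A v w + -(A v w) / (A w w + 1) * A w w)
      = -(A v w ^ 2 * (A w w + 2)) / (A w w + 1) ^ 2 := by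
    field_simp
    ring
  have h5 : -(A v w ^ 2 * (A w w + 2)) / (A w w + 1) ^ 2 < 0 := by
    apply div_neg_of_neg_of_pos
    · nlinarith
    · positivity
  simp at h1
  nlinarith

/-- Local infimal convolution of a strongly convex function and a convex function, near a common
critical point at the origin. `Y` is the map sending `z` to the point where the splitting
`z = (z - Y z) + Y z` has equal gradients. -/
theorem exists_splitting [FiniteDimensional ℝ V] {f g : V → ℝ} (hf : CHolderNear 2 0 f 0) (hg : CHolderNear 2 0 g 0)
    (hf0 : fderiv ℝ f 0 = 0) (hg0 : fderiv ℝ g 0 = 0) {A : V ≃L[ℝ] (V →L[ℝ] ℝ)}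
    (hA : HasFDerivAt (fderiv ℝ f) (A : V →L[ℝ] V →L[ℝ] ℝ) 0) (hApos : ∀ v, 0 ≤ A v v)
    (hBpos : ∀ v, 0 ≤ fderiv ℝ (fderiv ℝ g) 0 v v) :
    ∃ Y : V → V, Y 0 = 0 ∧ ContinuousAt Y 0 ∧
      (∀ᶠ z in 𝓝 0, fderiv ℝ f (z - Y z) = fderiv ℝ g (Y z)) ∧
      CHolderNear 2 0 (fun z => f (z - Y z) + g (Y z)) 0 ∧
      (∀ᶠ z in 𝓝 0, fderiv ℝ (fun z => f (z - Y z) + g (Y z)) z = fderiv ℝ g (Y z)) ∧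
      (Function.Injective (fderiv ℝ (fderiv ℝ g) 0) ↔
        Function.Injective (fderiv ℝ (fderiv ℝ fun z => f (z - Y z) + g (Y z)) 0)) ∧
      ∀ (k : WithTop ℕ∞) (α : ℝ≥0), 2 ≤ k → α ≤ 1 → CHolderNear k α f 0 →
        (CHolderNear k α g 0 ↔ CHolderNear k α (fun z => f (z - Y z) + g (Y z)) 0) := by
  have h2 : (2 : WithTop ℕ∞) = 1 + 1 := one_add_one_eq_two.symm
  have hf1 : CHolderNear 1 0 (fderiv ℝ f) 0 := (h2 ▸ hf).fderiv
  have hg1 : CHolderNear 1 0 (fderiv ℝ g) 0 := (h2 ▸ hg).fderiv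
  have hB : HasFDerivAt (fderiv ℝ g) (fderiv ℝ (fderiv ℝ g) 0) 0 :=
    (hg1.contDiffAt.differentiableAt one_ne_zero).hasFDerivAt
  set B := fderiv ℝ (fderiv ℝ g) 0
  have hAsymm : ∀ v w, A v w = A w v := by
    intro v w
    have h := (hf.contDiffAt.isSymmSndFDerivAt (by simp)) v w
    rwa [hA.fderiv] at h
  obtain ⟨φ, hφ0, hφ, hφ', hφl, hφr⟩ := hf1.exists_inverse zero_le_one le_rfl hA
  have hφk : ∀ (k : WithTop ℕ∞) (α : ℝ≥0), 1 ≤ k → α ≤ 1 → CHolderNear k α (fderiv ℝ f) 0 →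
      CHolderNear k α φ 0 := by
    intro k α hk hα h
    have := h.of_inverse hα hk hA hφ0 hφ.contDiffAt.continuousAt hφr
    rwa [hf0] at this
  rw [hf0] at hφ0 hφ hφ' hφr
  -- `Z y` is the point whose splitting has second part `y`: the first part `φ (Dg y)` is where `Df`
  -- equals `Dg y`.
  set Z : V → V := fun y => y + φ (fderiv ℝ g y) with hZ
  have hZ0 : Z 0 = 0 := by simp [hZ, hg0, hφ0]
  have hZk : ∀ (k : WithTop ℕ∞) (α : ℝ≥0), 1 ≤ k → α ≤ 1 → CHolderNear k α (fderiv ℝ f) 0 →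
      CHolderNear k α (fderiv ℝ g) 0 → CHolderNear k α Z 0 := fun k α hk hα h h' =>
    (CHolderNear.of_contDiff hα contDiff_id).add
      (CHolderNear.comp (g := φ) hα hk (by rw [hg0]; exact hφk k α hk hα h) h')
  have hZ' : HasFDerivAt Z (ContinuousLinearMap.id ℝ V + (A.symm : (V →L[ℝ] ℝ) →L[ℝ] V) ∘L B) 0 :=
    (hasFDerivAt_id 0).add (HasFDerivAt.comp (g := φ) 0 (by rwa [hg0]) hB)
  -- A kernel vector satisfies `A v = -B v`; both forms are nonnegative on the diagonal, so `A v v =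
  -- 0`, hence `A v = 0` and `v = 0`.
  have hinj : Function.Injective
      (ContinuousLinearMap.id ℝ V + (A.symm : (V →L[ℝ] ℝ) →L[ℝ] V) ∘L B) := by
    rw [injective_iff_map_eq_zero]
    intro v hv
    have h1 : A v = - B v := by
      have : A (v + A.symm (B v)) = 0 := by rw [show v + A.symm (B v) = 0 from hv, map_zero]
      rw [map_add, A.apply_symm_apply] at this
      exact eq_neg_of_add_eq_zero_left this
    have h3 : A v v = 0 := by
      have h4 := hApos v
      have h5 := hBpos v
      have h6 : A v v = - B v v := by rw [h1]; rfl
      linarith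
    have h4 := eq_zero_of_apply_self_eq_zero (A := (A : V →L[ℝ] V →L[ℝ] ℝ)) hAsymm hApos h3
    exact A.injective (h4.trans (map_zero A).symm)
  set Z' : V ≃L[ℝ] V := (LinearEquiv.ofInjectiveEndo _ hinj).toContinuousLinearEquiv
  replace hZ' : HasFDerivAt Z (Z' : V →L[ℝ] V) 0 := hZ'
  obtain ⟨Y, hY0, hY, hY', hYl, hYr⟩ :=
    (hZk 1 0 le_rfl zero_le_one hf1 hg1).exists_inverse zero_le_one le_rfl hZ'
  have hYk : ∀ (k : WithTop ℕ∞) (α : ℝ≥0), 1 ≤ k → α ≤ 1 → CHolderNear k α (fderiv ℝ f) 0 →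
      CHolderNear k α (fderiv ℝ g) 0 → CHolderNear k α Y 0 := by
    intro k α hk hα h h'
    have := (hZk k α hk hα h h').of_inverse hα hk hZ' hY0 hY.contDiffAt.continuousAt hYr
    rwa [hZ0] at this
  rw [hZ0] at hY0 hY hY' hYr
  have hYc := hY.contDiffAt.continuousAt
  have hYc0 : Tendsto Y (𝓝 0) (𝓝 0) := by simpa [ContinuousAt, hY0] using hYc
  have hDgY : Tendsto (fun z => fderiv ℝ g (Y z)) (𝓝 0) (𝓝 0) := by
    have := hg1.contDiffAt.continuousAt.tendsto.comp hYc0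
    rwa [hg0] at this
  have hφY : ∀ᶠ z in 𝓝 0, φ (fderiv ℝ g (Y z)) = z - Y z := by
    filter_upwards [hYr] with z hz
    exact eq_sub_of_add_eq' hz
  have hsplit : ∀ᶠ z in 𝓝 0, fderiv ℝ f (z - Y z) = fderiv ℝ g (Y z) := by
    filter_upwards [hφY, hDgY.eventually hφr] with z h3 h4
    rwa [h3] at h4
  have hX : ∀ {k : WithTop ℕ∞} {α : ℝ≥0}, α ≤ 1 → CHolderNear k α Y 0 →
      CHolderNear k α (fun z => z - Y z) 0 := fun hα h =>
    (CHolderNear.of_contDiff hα contDiff_id).sub h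
  set h : V → ℝ := fun z => f (z - Y z) + g (Y z) with hh
  have hhk : ∀ {k : WithTop ℕ∞} {α : ℝ≥0}, 1 ≤ k → α ≤ 1 → CHolderNear k α f 0 →
      CHolderNear k α g 0 → CHolderNear k α Y 0 → CHolderNear k α h 0 := fun hk hα h1 h3 h4 =>
    (CHolderNear.comp (g := f) hα hk (by simpa [hY0] using h1) (hX hα h4)).add
      (CHolderNear.comp (g := g) hα hk (by simpa [hY0] using h3) h4)
  -- Envelope identity: the two terms containing `DY` cancel because the gradients match.
  have hDh : ∀ᶠ z in 𝓝 0, fderiv ℝ h z = fderiv ℝ g (Y z) := by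
    have hXc0 : Tendsto (fun z => z - Y z) (𝓝 0) (𝓝 0) := by simpa using tendsto_id.sub hYc0
    filter_upwards [hsplit, hY.differentiableAt le_rfl,
      hXc0.eventually (hf.differentiableAt one_le_two),
      hYc0.eventually (hg.differentiableAt one_le_two)] with z h1 h3 h4 h5
    have h6 := (h4.hasFDerivAt.comp z ((hasFDerivAt_id z).sub h3.hasFDerivAt)).add
      (h5.hasFDerivAt.comp z h3.hasFDerivAt)
    rw [HasFDerivAt.fderiv (f := h) h6, h1]
    ext v
    simp
  -- The formula for `h` gives only the class `j` of `Y`; the missing derivative comes from `Dh = Dg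
  -- ∘ Y`.
  have hup : ∀ {j : WithTop ℕ∞} {α : ℝ≥0}, 1 ≤ j → α ≤ 1 → CHolderNear (j + 1) α f 0 →
      CHolderNear (j + 1) α g 0 → CHolderNear (j + 1) α h 0 := by
    intro j α hj hα h1 h3
    have hYj := hYk j α hj hα h1.fderiv h3.fderiv
    refine .of_fderiv hj (hhk hj hα (h1.of_succ hα) (h3.of_succ hα) hYj) ?_
    exact (CHolderNear.comp (g := fderiv ℝ g) hα hj (by rw [hY0]; exact h3.fderiv) hYj).congr
      (EventuallyEq.symm hDh)
  refine ⟨Y, hY0, hYc, hsplit, ?_, hDh, ?_, ?_⟩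
  · rw [h2]
    exact hup le_rfl zero_le_one (h2 ▸ hf) (h2 ▸ hg)
  · have h1 : HasFDerivAt (fderiv ℝ h) (B ∘L (Z'.symm : V →L[ℝ] V)) 0 :=
      HasFDerivAt.congr_of_eventuallyEq
        (HasFDerivAt.comp (g := fderiv ℝ g) 0 (by rwa [hY0]) hY') hDh
    rw [h1.fderiv]
    exact (Function.Injective.of_comp_iff' B Z'.symm.bijective).symm
  · intro k α hk hα hfk
    obtain ⟨j, rfl, hj⟩ := exists_eq_add_one_of_two_le hk
    refine ⟨hup hj hα hfk, fun hhj => ?_⟩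
    -- Converse: nothing beyond `C^2` is known of `g`, so `Y` is recovered from `h` as `id - φ ∘
    -- Dh`, then `Z` by inversion, and finally `g = h ∘ Z - f ∘ (Z - id)` with `Dg = Dh ∘ Z`.
    have hDh0 : fderiv ℝ h 0 = 0 := by rw [hDh.self_of_nhds, hY0, hg0]
    have hYj : CHolderNear j α Y 0 := by
      have h1 : CHolderNear j α (fun z => z - φ (fderiv ℝ h z)) 0 :=
        (CHolderNear.of_contDiff hα contDiff_id).sub (CHolderNear.comp (g := φ) hα hj
          (by rw [hDh0]; exact hφk j α hj hα hfk.fderiv) hhj.fderiv)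
      refine h1.congr ?_
      filter_upwards [hφY, hDh] with z h3 h4
      rw [h4, h3, sub_sub_cancel]
    have hZj : CHolderNear j α Z 0 := by
      have hY'' : HasFDerivAt Y (Z'.symm : V →L[ℝ] V) 0 := by simpa [hZ0] using hY'
      have h1 := hYj.of_inverse hα hj hY'' (g := Z) (by rw [hY0, hZ0])
        (by rw [hY0]; exact hZ'.continuousAt) (by simpa [hY0] using hYl)
      rwa [hY0] at h1
    have hZc0 : Tendsto Z (𝓝 0) (𝓝 0) := by simpa [ContinuousAt, hZ0] using hZ'.continuousAt
    refine .of_fderiv hj ?_ ?_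
    · have h1 : CHolderNear j α (fun y => h (Z y) - f (Z y - y)) 0 := by
        refine (CHolderNear.comp (g := h) hα hj ?_ hZj).sub (CHolderNear.comp (g := f) hα hj ?_
          (hZj.sub (.of_contDiff hα contDiff_id)))
        · rw [hZ0]; exact hhj.of_succ hα
        · simpa [hZ0] using hfk.of_succ hα
      refine h1.congr ?_
      filter_upwards [hYl] with y hy
      simp [hh, hy]
    · refine (CHolderNear.comp (g := fderiv ℝ h) hα hj (by rw [hZ0]; exact hhj.fderiv) hZj).congr ?_
      filter_upwards [hYl, hZc0.eventually hDh] with y h1 h3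
      rw [Function.comp_apply, h3, h1]

end InfConvolution

/-! ### Graphs over a hyperplane. -/

section Graph

variable {E : Type} [NormedAddCommGroup E] [InnerProductSpace ℝ E] {p u : E}

/-- The point of the graph of `-f` over the hyperplane `p + uᗮ`, in direction `u`. -/
def graphMap (p u : E) (f : (ℝ ∙ u)ᗮ → ℝ) (y : (ℝ ∙ u)ᗮ) : E := p + y - f y • u

/-- The set `S` is, near `p`, the graph of `-f` over the hyperplane `p + uᗮ`, in direction `u`. -/
def IsGraphNear (S : Set E) (p u : E) (f : (ℝ ∙ u)ᗮ → ℝ) : Prop :=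
  ∀ᶠ x in 𝓝 p, x ∈ S ↔ inner ℝ u (x - p) + f ((ℝ ∙ u)ᗮ.orthogonalProjectionOnto (x - p)) = 0

theorem inner_coe_hyperplane (y : (ℝ ∙ u)ᗮ) : inner ℝ u (y : E) = 0 :=
  Submodule.mem_orthogonal_singleton_iff_inner_right.1 y.2

theorem orthogonalProjectionOnto_hyperplane_self :
    (ℝ ∙ u)ᗮ.orthogonalProjectionOnto u = 0 := by
  rw [Submodule.orthogonalProjectionOnto_eq_zero_iff, Submodule.orthogonal_orthogonal]
  exact Submodule.mem_span_singleton_self u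

theorem inner_unit_self (hu : ‖u‖ = 1) : inner ℝ u u = 1 := by
  rw [real_inner_self_eq_norm_sq, hu, one_pow]

theorem inner_coe_add_smul (hu : ‖u‖ = 1) (y : (ℝ ∙ u)ᗮ) (t : ℝ) :
    inner ℝ u ((y : E) + t • u) = t := by
  rw [inner_add_right, inner_coe_hyperplane, inner_smul_right, inner_unit_self hu, zero_add,
    mul_one]

theorem coe_projection_add (hu : ‖u‖ = 1) (x : E) :
    ((ℝ ∙ u)ᗮ.orthogonalProjectionOnto x : E) + inner ℝ u x • u = x := by
  rw [Submodule.coe_orthogonalProjectionOnto_apply, Submodule.starProjection_orthogonal_val,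
    Submodule.starProjection_unit_singleton ℝ hu, sub_add_cancel]

variable {f : (ℝ ∙ u)ᗮ → ℝ}

theorem graphMap_sub (y : (ℝ ∙ u)ᗮ) : graphMap p u f y - p = y - f y • u := by
  rw [graphMap]; abel

theorem inner_graphMap (hu : ‖u‖ = 1) (y : (ℝ ∙ u)ᗮ) :
    inner ℝ u (graphMap p u f y - p) = - f y := by
  rw [graphMap_sub, inner_sub_right, inner_coe_hyperplane,
    inner_smul_right, inner_unit_self hu]
  ring

theorem projection_graphMap (y : (ℝ ∙ u)ᗮ) :
    (ℝ ∙ u)ᗮ.orthogonalProjectionOnto (graphMap p u f y - p) = y := by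
  rw [graphMap_sub, map_sub, map_smul,
    orthogonalProjectionOnto_hyperplane_self,
    Submodule.orthogonalProjectionOnto_mem_subspace_eq_self, smul_zero, sub_zero]

theorem eq_graphMap_sub (hu : ‖u‖ = 1) (x : E) :
    x = graphMap p u f ((ℝ ∙ u)ᗮ.orthogonalProjectionOnto (x - p)) +
      (inner ℝ u (x - p) + f ((ℝ ∙ u)ᗮ.orthogonalProjectionOnto (x - p))) • u := by
  have h := coe_projection_add hu (x - p)
  rw [graphMap, add_smul]
  nth_rewrite 1 [← sub_add_cancel x p, ← h]
  abel

theorem graphMap_zero (hf : f 0 = 0) : graphMap p u f 0 = p := by simp [graphMap, hf]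

theorem continuousAt_graphMap (hf : ContinuousAt f 0) : ContinuousAt (graphMap p u f) 0 := by
  unfold graphMap
  fun_prop

theorem tendsto_graphMap (hf0 : f 0 = 0) (hf : ContinuousAt f 0) :
    Tendsto (graphMap p u f) (𝓝 0) (𝓝 p) := by
  simpa [ContinuousAt, graphMap_zero hf0] using continuousAt_graphMap (p := p) hf

theorem tendsto_projection :
    Tendsto (fun x => (ℝ ∙ u)ᗮ.orthogonalProjectionOnto (x - p)) (𝓝 p) (𝓝 0) := by
  have h : ContinuousAt (fun x => (ℝ ∙ u)ᗮ.orthogonalProjectionOnto (x - p)) p := by fun_prop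
  simpa [ContinuousAt] using h

namespace IsGraphNear

variable {S : Set E}

theorem graphMap_mem (h : IsGraphNear S p u f) (hu : ‖u‖ = 1) (hf0 : f 0 = 0)
    (hf : ContinuousAt f 0) : ∀ᶠ y in 𝓝 0, graphMap p u f y ∈ S := by
  filter_upwards [(tendsto_graphMap hf0 hf).eventually h] with y hy
  rw [hy, inner_graphMap hu, projection_graphMap, neg_add_cancel]

/-- The germ of the graph function is determined by the set, so its regularity may be read off from
any description of the boundary. -/
theorem unique (h : IsGraphNear S p u f) (hu : ‖u‖ = 1) (hf0 : f 0 = 0)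
    (hf : ContinuousAt f 0) {g : (ℝ ∙ u)ᗮ → ℝ} (h' : IsGraphNear S p u g) : f =ᶠ[𝓝 0] g := by
  filter_upwards [h.graphMap_mem hu hf0 hf, (tendsto_graphMap hf0 hf).eventually h'] with y h1 h2
  rw [h2, inner_graphMap hu, projection_graphMap] at h1
  linarith

end IsGraphNear

/-- The Riesz representation, as a real-linear map. -/
noncomputable def rieszRep (V : Type) [NormedAddCommGroup V] [InnerProductSpace ℝ V] [CompleteSpace V] :
    (V →L[ℝ] ℝ) →L[ℝ] V where
  toFun := (InnerProductSpace.toDual ℝ V).symm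
  map_add' := map_add _
  map_smul' c φ := by simp
  cont := (InnerProductSpace.toDual ℝ V).symm.continuous

theorem inner_rieszRep {V : Type} [NormedAddCommGroup V] [InnerProductSpace ℝ V] [CompleteSpace V]
    (φ : V →L[ℝ] ℝ) (v : V) : inner ℝ (rieszRep V φ) v = φ v :=
  InnerProductSpace.toDual_symm_apply

theorem rieszRep_injective {V : Type} [NormedAddCommGroup V] [InnerProductSpace ℝ V]
    [CompleteSpace V] : Function.Injective (rieszRep V) :=
  (InnerProductSpace.toDual ℝ V).symm.injective

end Graph

/-! ### Hypersurface charts versus graphs over the supporting hyperplane. -/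

section Charts

variable {n : ℕ}

variable {C : ConvexBody (EuclideanSpace ℝ (Fin n))} {p u : EuclideanSpace ℝ (Fin n)} {k : WithTop ℕ∞} {α : ℝ≥0}

/-- Implicit function theorem for the local equation `⟨e, Φ x⟩ = 0`. Support by `u` forces the
tangent space to be `uᗮ`, so the equation is transversal to `u` and can be solved for the height. -/
theorem exists_isGraphNear_of_isCHolderNear (hα : α ≤ 1) (hk : 1 ≤ k) (hC : C.IsCHolderNear k α p)
    (hp : p ∈ frontier (C : Set (EuclideanSpace ℝ (Fin n)))) (hu : C.IsUnitOuterNormal p u) :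
    ∃ f : (ℝ ∙ u)ᗮ → ℝ, f 0 = 0 ∧ CHolderNear k α f 0 ∧
      IsGraphNear (frontier (C : Set (EuclideanSpace ℝ (Fin n)))) p u f := by
  obtain ⟨U, hU, hpU, hS⟩ := hC
  obtain ⟨Φ, hpΦ, hΦ, hΦs, e, he, hSΦ⟩ := hS p ⟨hp, hpU⟩
  have hk0 : k ≠ 0 := (zero_lt_one.trans_le hk).ne'
  have hΦp : CHolderNear k α Φ p := by
    filter_upwards [Φ.open_source.mem_nhds hpΦ] with x hx
      using (isCHolderOn_iff Φ.open_source).1 hΦ x hx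
  have hD : HasFDerivAt Φ (fderiv ℝ Φ p) p :=
    (hΦp.contDiffAt.differentiableAt hk0).hasFDerivAt
  have hD' : HasFDerivAt Φ.symm (fderiv ℝ Φ.symm (Φ p)) (Φ p) :=
    (((isCHolderOn_iff Φ.open_target).1 hΦs _ (Φ.map_source hpΦ)).1.differentiableAt
      hk0).hasFDerivAt
  set D := fderiv ℝ Φ p
  set D' := fderiv ℝ Φ.symm (Φ p)
  have hDD : ∀ v, D' (D v) = v := by
    intro v
    have h1 : HasFDerivAt id (D' ∘L D) p := by
      refine (hD'.comp p hD).congr_of_eventuallyEq ?_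
      filter_upwards [Φ.open_source.mem_nhds hpΦ] with x hx using (Φ.left_inv hx).symm
    exact DFunLike.congr_fun (h1.unique (hasFDerivAt_id p)) v
  have hFp : inner ℝ e (Φ p) = 0 := (hSΦ p hpΦ).1 ⟨hp, hpU⟩
  -- Along a curve in the boundary through `p` the height in direction `u` is maximal at `p`, so its
  -- velocity is orthogonal to `u`.
  have htan : ∀ w, inner ℝ e w = 0 → inner ℝ u (D' w) = 0 := by
    intro w hw
    have hl : HasDerivAt (fun t : ℝ => Φ p + t • w) w 0 := by
      simpa using ((hasDerivAt_id (0 : ℝ)).smul_const w).const_add (Φ p)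
    have h1 : HasDerivAt (fun t : ℝ => inner ℝ u (Φ.symm (Φ p + t • w) - p))
        (inner ℝ u (D' w)) 0 := by
      have h2 : HasDerivAt (fun t : ℝ => Φ.symm (Φ p + t • w)) (D' w) 0 :=
        HasFDerivAt.comp_hasDerivAt (l := Φ.symm) 0 (by simpa using hD') hl
      exact (innerSL ℝ u).hasFDerivAt.comp_hasDerivAt 0 (h2.sub_const p)
    refine IsLocalMax.hasDerivAt_eq_zero ?_ h1
    have h3 : ∀ᶠ t : ℝ in 𝓝 0, Φ p + t • w ∈ Φ.target := by
      refine hl.continuousAt.eventually ?_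
      simpa using Φ.open_target.mem_nhds (Φ.map_source hpΦ)
    filter_upwards [h3] with t ht
    have h4 : Φ.symm (Φ p + t • w) ∈ frontier (C : Set (EuclideanSpace ℝ (Fin n))) ∩ U := by
      rw [hSΦ _ (Φ.map_target ht), Φ.right_inv ht, inner_add_right, inner_smul_right, hFp, hw]
      simp
    have h5 := hu.2 _ (C.isClosed.frontier_subset h4.1)
    simpa [Φ.left_inv hpΦ] using h5
  have hee : inner ℝ e e ≠ 0 := inner_self_ne_zero.2 he
  obtain ⟨c, hc⟩ : ∃ c : ℝ, ∀ v, inner ℝ u v = c * inner ℝ e (D v) := by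
    refine ⟨inner ℝ u (D' e) / inner ℝ e e, fun v => ?_⟩
    have h1 := htan (D v - (inner ℝ e (D v) / inner ℝ e e) • e) (by
      rw [inner_sub_right, inner_smul_right]
      field_simp
      ring)
    rw [map_sub, hDD, map_smul, inner_sub_right, inner_smul_right] at h1
    rw [← sub_eq_zero, ← h1]
    ring
  set P := (ℝ ∙ u)ᗮ.orthogonalProjectionOnto
  -- `Ψ` keeps the projection to `uᗮ` and replaces the height by the defining function; its inverse
  -- on `uᗮ` parametrizes the boundary.
  set Ψ : EuclideanSpace ℝ (Fin n) → EuclideanSpace ℝ (Fin n) := fun x => ((P (x - p) : (ℝ ∙ u)ᗮ) : EuclideanSpace ℝ (Fin n)) + inner ℝ e (Φ x) • u with hΨ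
  have hΨk : CHolderNear k α Ψ p := by
    refine CHolderNear.add (.of_contDiff hα ?_) ?_
    · exact ((ℝ ∙ u)ᗮ.subtypeL ∘L P).contDiff.comp (contDiff_id.sub contDiff_const)
    · exact hΦp.clm_comp ((innerSL ℝ e).smulRight u)
  have hΨ' : HasFDerivAt Ψ ((ℝ ∙ u)ᗮ.subtypeL ∘L P + (innerSL ℝ e).smulRight u ∘L D) p :=
    (HasFDerivAt.comp (f := fun x => x - p) p ((ℝ ∙ u)ᗮ.subtypeL ∘L P).hasFDerivAt
      ((hasFDerivAt_id p).sub_const p)).add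
      (((innerSL ℝ e).smulRight u).hasFDerivAt.comp p hD)
  have hinj : Function.Injective
      ((ℝ ∙ u)ᗮ.subtypeL ∘L P + (innerSL ℝ e).smulRight u ∘L D) := by
    rw [injective_iff_map_eq_zero]
    intro v hv
    replace hv : ((P v : (ℝ ∙ u)ᗮ) : EuclideanSpace ℝ (Fin n)) + inner ℝ e (D v) • u = 0 := hv
    have h1 : inner ℝ e (D v) = 0 := by
      have := congrArg (inner ℝ u) hv
      rwa [inner_coe_add_smul hu.1, inner_zero_right] at this
    have h2 := coe_projection_add hu.1 v
    rw [hc, h1, mul_zero, zero_smul, add_zero] at h2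
    rw [h1, zero_smul, add_zero] at hv
    rw [← h2, ← hv]
  set Ψ' : EuclideanSpace ℝ (Fin n) ≃L[ℝ] EuclideanSpace ℝ (Fin n) := (LinearEquiv.ofInjectiveEndo _ hinj).toContinuousLinearEquiv
  have hΨp : Ψ p = 0 := by simp [hΨ, hFp]
  obtain ⟨Θ, hΘp, hΘ, -, hΘl, hΘr⟩ :=
    hΨk.exists_inverse hα hk (f' := Ψ') hΨ'
  rw [hΨp] at hΘp hΘ hΘr
  have hΘf : CHolderNear k α (fun y : (ℝ ∙ u)ᗮ => inner ℝ u (Θ y - p)) 0 := by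
    have h1 : CHolderNear k α (fun z => inner ℝ u (Θ z - p)) 0 :=
      (hΘ.sub (.of_contDiff hα contDiff_const)).clm_comp (innerSL ℝ u)
    exact CHolderNear.comp_contDiff (g := fun z => inner ℝ u (Θ z - p)) hα (by simpa using h1)
      (ℝ ∙ u)ᗮ.subtypeL.contDiff
  refine ⟨fun y => - inner ℝ u (Θ y - p), by simp [hΘp],
    hΘf.clm_comp (-ContinuousLinearMap.id ℝ ℝ), ?_⟩
  have hPz : Tendsto (fun x => ((P (x - p) : (ℝ ∙ u)ᗮ) : EuclideanSpace ℝ (Fin n))) (𝓝 p) (𝓝 0) := by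
    exact (continuous_subtype_val.tendsto (0 : (ℝ ∙ u)ᗮ)).comp tendsto_projection
  filter_upwards [hU.mem_nhds hpU, Φ.open_source.mem_nhds hpΦ, hΘl, hPz.eventually hΘr]
    with x hxU hxΦ hxl hxr
  have hxS : x ∈ frontier (C : Set (EuclideanSpace ℝ (Fin n))) ↔ inner ℝ e (Φ x) = 0 := by
    rw [← hSΦ x hxΦ]; exact ⟨fun h => ⟨h, hxU⟩, fun h => h.1⟩
  rw [hxS]
  constructor
  · intro h
    have h1 : Ψ x = P (x - p) := by simp [hΨ, h]
    rw [← h1, hxl, add_neg_cancel]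
  · intro h
    -- `x'` is the boundary point with the same projection as `x`; equal heights force `x' = x`.
    set x' := Θ (P (x - p)) with hx'
    have h1 : ((P (x' - p) : (ℝ ∙ u)ᗮ) : EuclideanSpace ℝ (Fin n)) + inner ℝ e (Φ x') • u = P (x - p) := hxr
    have h2 : inner ℝ e (Φ x') = 0 := by
      have := congrArg (inner ℝ u) h1
      rwa [inner_coe_add_smul hu.1, inner_coe_hyperplane] at this
    rw [h2, zero_smul, add_zero] at h1
    have h3 : inner ℝ u (x - p) = inner ℝ u (x' - p) := by linarith
    have h4 : x' - p = x - p := by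
      rw [← coe_projection_add hu.1 (x' - p), ← coe_projection_add hu.1 (x - p), h3]
      exact congrArg (· + _) h1
    rw [← sub_left_injective h4]
    exact h2

/-- The shear adding `f` to the height flattens the graph. Its inverse is explicit, so no inverse
function theorem is needed and `k = 0` is covered. -/
theorem IsGraphNear.isCHolderNear {f : (ℝ ∙ u)ᗮ → ℝ} (hα : α ≤ 1) (hu : ‖u‖ = 1)
    (h : IsGraphNear (frontier (C : Set (EuclideanSpace ℝ (Fin n)))) p u f) (hf : CHolderNear k α f 0) :
    C.IsCHolderNear k α p := by
  obtain ⟨W, hWf, hW, h0W⟩ := eventually_nhds_iff.1 hf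
  obtain ⟨O, hO, hOo, hpO⟩ := eventually_nhds_iff.1 h
  set P := (ℝ ∙ u)ᗮ.orthogonalProjectionOnto
  have hPu : P u = 0 := orthogonalProjectionOnto_hyperplane_self
  have hcont : ContinuousOn f W := fun y hy => (hWf y hy).1.continuousAt.continuousWithinAt
  let Φ : OpenPartialHomeomorph (EuclideanSpace ℝ (Fin n)) (EuclideanSpace ℝ (Fin n)) :=
    { toFun := fun x => x - p + f (P (x - p)) • u
      invFun := fun z => p + z - f (P z) • u
      source := {x | P (x - p) ∈ W}
      target := {z | P z ∈ W}
      map_source' := fun x hx => by simpa [hPu] using hx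
      map_target' := fun z hz => by
        have : p + z - f (P z) • u - p = z - f (P z) • u := by abel
        simpa [this, hPu] using hz
      left_inv' := fun x hx => by
        simp only [map_add, map_smul, hPu, smul_zero, add_zero]
        abel
      right_inv' := fun z hz => by
        have : p + z - f (P z) • u - p = z - f (P z) • u := by abel
        simp [this, hPu]
      open_source := hW.preimage (by fun_prop)
      open_target := hW.preimage (by fun_prop)
      continuousOn_toFun := ContinuousOn.add (by fun_prop)
        ((hcont.comp (f := fun x => P (x - p)) (by fun_prop) fun x hx => hx).smul
          continuousOn_const)
      continuousOn_invFun := ContinuousOn.sub (by fun_prop)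
        ((hcont.comp (f := P) (by fun_prop) fun x hx => hx).smul continuousOn_const) }
  have hΦ : IsCHolderOn k α Φ Φ.source := by
    rw [isCHolderOn_iff Φ.open_source]
    intro x hx
    have h1 : ContDiff ℝ ω fun x => P (x - p) :=
      P.contDiff.comp (contDiff_id.sub contDiff_const)
    refine CHolderAt.add (.of_contDiff_top hα (contDiff_id.sub contDiff_const)) ?_
    exact (CHolderAt.comp (g := f) (f := fun x => P (x - p)) hα (hWf _ hx) (.of_contDiff_top hα h1)
      (h1.contDiffAt.of_le le_top)).clm_comp ((ContinuousLinearMap.id ℝ ℝ).smulRight u)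
  have hΦs : IsCHolderOn k α Φ.symm Φ.target := by
    rw [isCHolderOn_iff Φ.open_target]
    intro z hz
    have h1 := (CHolderAt.comp (g := f) hα (hWf _ hz) (.of_contDiff_top hα P.contDiff)
      P.contDiff.contDiffAt).clm_comp (-(ContinuousLinearMap.id ℝ ℝ).smulRight u)
    have h2 := CHolderAt.add (CHolderAt.of_contDiff_top (x := z) (k := k) hα
      (contDiff_const (c := p).add contDiff_id)) h1
    refine h2.congr (.of_forall fun z => ?_)
    simp [Φ, sub_eq_add_neg]
  refine ⟨Φ.source ∩ O, Φ.open_source.inter hOo, ⟨by simpa [Φ] using h0W, hpO⟩, ?_⟩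
  rintro q ⟨-, hqΦ, hqO⟩
  refine ⟨Φ.restrOpen O hOo, ⟨hqΦ, hqO⟩, hΦ.mono Set.inter_subset_left,
    hΦs.mono Set.inter_subset_left, u, by rintro rfl; simp at hu, ?_⟩
  rintro x ⟨hxΦ, hxO⟩
  have h1 : inner ℝ u (Φ x) = inner ℝ u (x - p) + f (P (x - p)) := by
    change inner ℝ u (x - p + f (P (x - p)) • u) = _
    rw [inner_add_right, inner_smul_right, inner_unit_self hu, mul_one]
  rw [show (Φ.restrOpen O hOo) x = Φ x from rfl, h1, ← hO x hxO]
  exact ⟨fun h => h.1, fun h => ⟨h, hxΦ, hxO⟩⟩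

end Charts

/-! ### Supporting normals, regularity and curvature in graph coordinates. -/

section Bodies

variable {n : ℕ} {C : ConvexBody (EuclideanSpace ℝ (Fin n))} {p u v q : EuclideanSpace ℝ (Fin n)}

namespace ConvexBody

theorem inner_lt_of_mem_interior (hv : v ≠ 0) (h : ∀ x ∈ C, inner ℝ v (x - p) ≤ 0)
    (hq : q ∈ interior (C : Set (EuclideanSpace ℝ (Fin n)))) : inner ℝ v (q - p) < 0 := by
  have hc : ContinuousAt (fun t : ℝ => q + t • v) 0 := by fun_prop
  have h1 : ∀ᶠ t : ℝ in 𝓝 0, q + t • v ∈ (C : Set (EuclideanSpace ℝ (Fin n))) :=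
    hc (by simpa using mem_interior_iff_mem_nhds.1 hq)
  obtain ⟨t, ht, ht0⟩ := ((h1.filter_mono nhdsWithin_le_nhds).and
    (self_mem_nhdsWithin (a := (0 : ℝ)) (s := Set.Ioi 0))).exists
  have h2 := h _ ht
  rw [add_sub_right_comm, inner_add_right, inner_smul_right] at h2
  have h3 : 0 < inner ℝ v v := real_inner_self_pos.2 hv
  have h4 : 0 < t * inner ℝ v v := mul_pos ht0 h3
  linarith

theorem exists_isUnitOuterNormal_of_forall_interior
    (hC : (interior (C : Set (EuclideanSpace ℝ (Fin n)))).Nonempty)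
    (hv : ∀ x ∈ interior (C : Set (EuclideanSpace ℝ (Fin n))), inner ℝ v x < inner ℝ v p) :
    v ≠ 0 ∧ C.IsUnitOuterNormal p (‖v‖⁻¹ • v) := by
  have hv0 : v ≠ 0 := by
    rintro rfl
    obtain ⟨x, hx⟩ := hC
    simpa using hv x hx
  refine ⟨hv0, norm_smul_inv_norm hv0, fun x hx => ?_⟩
  have hx' : x ∈ closure (interior (C : Set (EuclideanSpace ℝ (Fin n)))) := by
    rw [C.convex.closure_interior_eq_closure_of_nonempty_interior hC]
    exact subset_closure hx
  have h1 : inner ℝ v x ≤ inner ℝ v p :=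
    closure_minimal (t := {y | inner ℝ v y ≤ inner ℝ v p}) (fun y hy => (hv y hy).le)
      (isClosed_le (by fun_prop) continuous_const) hx'
  rw [real_inner_smul_left, inner_sub_right]
  exact mul_nonpos_of_nonneg_of_nonpos (by positivity) (by linarith)

theorem exists_isUnitOuterNormal
    (hC : (interior (C : Set (EuclideanSpace ℝ (Fin n)))).Nonempty)
    (hp : p ∈ frontier (C : Set (EuclideanSpace ℝ (Fin n)))) : ∃ v, C.IsUnitOuterNormal p v := by
  obtain ⟨φ, hφ⟩ := geometric_hahn_banach_open_point C.convex.interior isOpen_interior hp.2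
  refine ⟨_, (exists_isUnitOuterNormal_of_forall_interior
    (v := (InnerProductSpace.toDual ℝ _).symm φ) hC fun x hx => ?_).2⟩
  simpa only [InnerProductSpace.toDual_symm_apply] using hφ x hx

/-- If the ray in direction `-u` missed the interior, a separating functional would be a positive
multiple of a normal at `p`, hence of `u`, yet bounded below along that ray. -/
theorem exists_sub_smul_mem_interior
    (hC : (interior (C : Set (EuclideanSpace ℝ (Fin n)))).Nonempty) (hp : p ∈ C)
    (huniq : ∀ v, C.IsUnitOuterNormal p v → v = u) :
    ∃ t : ℝ, 0 < t ∧ p - t • u ∈ interior (C : Set (EuclideanSpace ℝ (Fin n))) := by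
  by_contra! hcon
  obtain ⟨φ, s, h1, h2⟩ := geometric_hahn_banach_open C.convex.interior isOpen_interior
    (t := (fun t : ℝ => p - t • u) '' Set.Ioi 0) (by
      rintro _ ⟨a, ha, rfl⟩ _ ⟨b, hb, rfl⟩ r r' hr hr' hrr
      have ha' : 0 < a := ha
      have hb' : 0 < b := hb
      refine ⟨r * a + r' * b, ?_, ?_⟩
      · rcases hr.eq_or_lt with rfl | hr
        · obtain rfl : r' = 1 := by linarith
          simpa using hb'
        · exact add_pos_of_pos_of_nonneg (mul_pos hr ha') (mul_nonneg hr' hb'.le)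
      · obtain rfl : r' = 1 - r := by linarith
        module)
    (Set.disjoint_right.2 (by rintro _ ⟨t, ht, rfl⟩; exact hcon t ht))
  set v := (InnerProductSpace.toDual ℝ _).symm φ
  have hv : ∀ x, φ x = inner ℝ v x := fun x => InnerProductSpace.toDual_symm_apply.symm
  have h3 : s ≤ φ p := by
    have hc : Tendsto (fun t : ℝ => φ (p - t • u)) (𝓝[>] 0) (𝓝 (φ p)) := by
      have : ContinuousAt (fun t : ℝ => φ (p - t • u)) 0 := by fun_prop
      simpa [ContinuousAt] using this.tendsto.mono_left nhdsWithin_le_nhds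
    refine ge_of_tendsto hc ?_
    filter_upwards [self_mem_nhdsWithin] with t ht using h2 _ ⟨t, ht, rfl⟩
  have h4 : φ p ≤ s := by
    have hx' : p ∈ closure (interior (C : Set (EuclideanSpace ℝ (Fin n)))) := by
      rw [C.convex.closure_interior_eq_closure_of_nonempty_interior hC]
      exact subset_closure hp
    exact closure_minimal (t := {y | φ y ≤ s}) (fun y hy => (h1 y hy).le)
      (isClosed_le (by fun_prop) continuous_const) hx'
  obtain ⟨hv0, hvn⟩ := exists_isUnitOuterNormal_of_forall_interior (v := v) (p := p) hC
    fun x hx => by rw [← hv, ← hv]; exact (h1 x hx).trans_le h3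
  have h5 := h2 _ ⟨1, Set.mem_Ioi.2 one_pos, rfl⟩
  have h6 : φ u ≤ 0 := by
    simp only [one_smul, map_sub] at h5
    linarith
  rw [hv, ← huniq _ hvn, inner_smul_right] at h6
  have h7 : 0 < ‖v‖⁻¹ * inner ℝ v v :=
    mul_pos (inv_pos.2 (norm_pos_iff.2 hv0)) (real_inner_self_pos.2 hv0)
  linarith

/-- Near the boundary point `p`, where `u` is a unit outer normal, the boundary of `C` is the
graph of the `C^2` function `-f` over the supporting hyperplane. -/
structure IsGraphAt (C : ConvexBody (EuclideanSpace ℝ (Fin n))) (p u : EuclideanSpace ℝ (Fin n))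
    (f : (ℝ ∙ u)ᗮ → ℝ) : Prop where
  normal : C.IsUnitOuterNormal p u
  interior_nonempty : (interior (C : Set (EuclideanSpace ℝ (Fin n)))).Nonempty
  contDiffAt : ContDiffAt ℝ 2 f 0
  map_zero : f 0 = 0
  isGraphNear : IsGraphNear (frontier (C : Set (EuclideanSpace ℝ (Fin n)))) p u f

end ConvexBody

/-- The upward normal vector `u + ∇f(y)` of the graph of `-f`. -/
noncomputable def graphNormal (u : EuclideanSpace ℝ (Fin n)) (f : (ℝ ∙ u)ᗮ → ℝ) (y : (ℝ ∙ u)ᗮ) :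
    EuclideanSpace ℝ (Fin n) :=
  u + (rieszRep (ℝ ∙ u)ᗮ (fderiv ℝ f y) : EuclideanSpace ℝ (Fin n))

theorem inner_graphNormal (hu : ‖u‖ = 1) (f : (ℝ ∙ u)ᗮ → ℝ) (y w : (ℝ ∙ u)ᗮ) (t : ℝ) :
    inner ℝ (graphNormal u f y) ((w : EuclideanSpace ℝ (Fin n)) + t • u)
      = fderiv ℝ f y w + t := by
  rw [graphNormal, inner_add_left, inner_coe_add_smul hu, inner_add_right, inner_smul_right,
    real_inner_comm u, inner_coe_hyperplane, ← Submodule.coe_inner, inner_rieszRep]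
  ring

theorem graphNormal_ne_zero (hu : ‖u‖ = 1) (f : (ℝ ∙ u)ᗮ → ℝ) (y : (ℝ ∙ u)ᗮ) :
    graphNormal u f y ≠ 0 := by
  intro h
  have := inner_graphNormal hu f y 0 1
  simp [h] at this

theorem norm_sq_graphNormal (hu : ‖u‖ = 1) (f : (ℝ ∙ u)ᗮ → ℝ) (y : (ℝ ∙ u)ᗮ) :
    ‖graphNormal u f y‖ ^ 2 = 1 + ‖rieszRep (ℝ ∙ u)ᗮ (fderiv ℝ f y)‖ ^ 2 := by
  have h := inner_graphNormal hu f y (rieszRep (ℝ ∙ u)ᗮ (fderiv ℝ f y)) 1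
  rw [one_smul, add_comm _ u, ← graphNormal, real_inner_self_eq_norm_sq, ← inner_rieszRep,
    real_inner_self_eq_norm_sq] at h
  rw [h, add_comm]

namespace ConvexBody.IsGraphAt

variable {f : (ℝ ∙ u)ᗮ → ℝ}

theorem norm_eq (h : C.IsGraphAt p u f) : ‖u‖ = 1 := h.normal.1

theorem continuousAt (h : C.IsGraphAt p u f) : ContinuousAt f 0 := h.contDiffAt.continuousAt

theorem mem_frontier (h : C.IsGraphAt p u f) :
    p ∈ frontier (C : Set (EuclideanSpace ℝ (Fin n))) := by
  rw [h.isGraphNear.self_of_nhds, sub_self, inner_zero_right, _root_.map_zero, h.map_zero, add_zero]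

theorem graphMap_mem (h : C.IsGraphAt p u f) :
    ∀ᶠ y in 𝓝 0, graphMap p u f y ∈ frontier (C : Set (EuclideanSpace ℝ (Fin n))) :=
  h.isGraphNear.graphMap_mem h.norm_eq h.map_zero h.continuousAt

theorem cHolderNear (h : C.IsGraphAt p u f) : CHolderNear 2 0 f 0 :=
  .of_contDiffAt_of_ne (by norm_cast) h.contDiffAt

theorem tendsto_graphMap (h : C.IsGraphAt p u f) : Tendsto (graphMap p u f) (𝓝 0) (𝓝 p) :=
  _root_.tendsto_graphMap h.map_zero h.continuousAt

theorem continuousAt_fderiv (h : C.IsGraphAt p u f) : ContinuousAt (fderiv ℝ f) 0 :=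
  h.contDiffAt.continuousAt_fderiv two_ne_zero

theorem continuousAt_graphNormal (h : C.IsGraphAt p u f) : ContinuousAt (graphNormal u f) 0 :=
  continuousAt_const.add (continuous_subtype_val.continuousAt.comp
    ((rieszRep (ℝ ∙ u)ᗮ).continuous.continuousAt.comp h.continuousAt_fderiv))

/-- A supporting functional is maximal on the graph at `y`, so it kills the tangent vectors `w -
(Df(y) w) u`; the factor is its `u`-component because that of the graph normal is 1. -/
theorem eq_smul_graphNormal (h : C.IsGraphAt p u f) : ∀ᶠ y in 𝓝 0, ∀ v,
    (∀ x ∈ C, inner ℝ v (x - graphMap p u f y) ≤ 0) → v = inner ℝ u v • graphNormal u f y := by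
  filter_upwards [h.graphMap_mem.eventually_nhds, h.cHolderNear.differentiableAt one_le_two]
    with y h1 h2 v hv
  have hder : HasFDerivAt (fun y' => inner ℝ v (graphMap p u f y' - graphMap p u f y))
      (innerSL ℝ v ∘L ((ℝ ∙ u)ᗮ.subtypeL - (fderiv ℝ f y).smulRight u)) y := by
    have h3 : HasFDerivAt (graphMap p u f) ((ℝ ∙ u)ᗮ.subtypeL - (fderiv ℝ f y).smulRight u) y :=
      ((ℝ ∙ u)ᗮ.subtypeL.hasFDerivAt.const_add p).sub (h2.hasFDerivAt.smul_const u)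
    exact (innerSL ℝ v).hasFDerivAt.comp y (h3.sub_const _)
  have hmax : IsLocalMax (fun y' => inner ℝ v (graphMap p u f y' - graphMap p u f y)) y := by
    filter_upwards [h1] with y' hy'
    simpa using hv _ (C.isClosed.frontier_subset hy')
  have h3 := hmax.hasFDerivAt_eq_zero hder
  have h4 : ∀ w : (ℝ ∙ u)ᗮ, inner ℝ v (w : EuclideanSpace ℝ (Fin n))
      = fderiv ℝ f y w * inner ℝ u v := by
    intro w
    have h5 : inner ℝ v ((w : EuclideanSpace ℝ (Fin n)) - fderiv ℝ f y w • u) = 0 :=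
      DFunLike.congr_fun h3 w
    rw [inner_sub_right, inner_smul_right, real_inner_comm u v] at h5
    linarith
  refine ext_inner_right ℝ fun x => ?_
  rw [← coe_projection_add h.norm_eq x, real_inner_smul_left, inner_graphNormal h.norm_eq,
    inner_add_right, h4, inner_smul_right, real_inner_comm u v]
  ring

theorem fderiv_zero (h : C.IsGraphAt p u f) : fderiv ℝ f 0 = 0 := by
  have h1 := h.eq_smul_graphNormal.self_of_nhds u (by
    rw [graphMap_zero h.map_zero]; exact h.normal.2)
  rw [inner_unit_self h.norm_eq, one_smul, graphNormal, left_eq_add,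
    Submodule.coe_eq_zero] at h1
  exact rieszRep_injective (h1.trans (_root_.map_zero _).symm)

theorem graphNormal_zero (h : C.IsGraphAt p u f) : graphNormal u f 0 = u := by
  simp [graphNormal, h.fderiv_zero]

/-- The sign is fixed by an interior point `q`: both `v` and, by continuity from `u`, the graph
normal are negative on `q - graphMap p u f y`. -/
theorem eventually_exists_pos (h : C.IsGraphAt p u f) : ∀ᶠ y in 𝓝 0, ∀ v,
    v ≠ 0 → (∀ x ∈ C, inner ℝ v (x - graphMap p u f y) ≤ 0) →
    ∃ c : ℝ, 0 < c ∧ v = c • graphNormal u f y := by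
  obtain ⟨q, hq⟩ := h.interior_nonempty
  have h1 : ContinuousAt (fun y => inner ℝ (graphNormal u f y) (q - graphMap p u f y)) 0 :=
    h.continuousAt_graphNormal.inner
      (continuousAt_const.sub (continuousAt_graphMap h.continuousAt))
  have h2 : ∀ᶠ y in 𝓝 0, inner ℝ (graphNormal u f y) (q - graphMap p u f y) < 0 := by
    refine h1.eventually_lt continuousAt_const ?_
    rw [h.graphNormal_zero, graphMap_zero h.map_zero]
    exact inner_lt_of_mem_interior (by rintro rfl; simpa using h.norm_eq) h.normal.2 hq
  filter_upwards [h.eq_smul_graphNormal, h2] with y h3 h4 v hv0 hv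
  refine ⟨inner ℝ u v, ?_, h3 v hv⟩
  have h5 := inner_lt_of_mem_interior hv0 hv hq
  rw [h3 v hv, real_inner_smul_left] at h5
  nlinarith

/-- Some supporting normal exists, and it is a positive multiple of the graph normal; so local
derivative data control the whole body. -/
theorem eventually_inner_graphNormal_nonpos (h : C.IsGraphAt p u f) : ∀ᶠ y in 𝓝 0,
    ∀ x ∈ C, inner ℝ (graphNormal u f y) (x - graphMap p u f y) ≤ 0 := by
  filter_upwards [h.eventually_exists_pos, h.graphMap_mem] with y h1 h2 x hx
  obtain ⟨v, hv⟩ := exists_isUnitOuterNormal h.interior_nonempty h2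
  obtain ⟨c, hc, rfl⟩ := h1 v (by rintro rfl; simpa using hv.1) hv.2
  have h3 := hv.2 x hx
  rw [real_inner_smul_left] at h3
  exact nonpos_of_mul_nonpos_right h3 hc

theorem eventually_eq_of_isUnitOuterNormal (h : C.IsGraphAt p u f) : ∀ᶠ y in 𝓝 0, ∀ v,
    C.IsUnitOuterNormal (graphMap p u f y) v → v = ‖graphNormal u f y‖⁻¹ • graphNormal u f y := by
  filter_upwards [h.eventually_exists_pos] with y h1 v hv
  obtain ⟨c, hc, rfl⟩ := h1 v (by rintro rfl; simpa using hv.1) hv.2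
  have h2 := hv.1
  rw [norm_smul, Real.norm_of_nonneg hc.le] at h2
  rw [eq_inv_of_mul_eq_one_left h2]

theorem eq_of_isUnitOuterNormal (h : C.IsGraphAt p u f) (hv : C.IsUnitOuterNormal p v) :
    v = u := by
  have := h.eventually_eq_of_isUnitOuterNormal.self_of_nhds v (by rwa [graphMap_zero h.map_zero])
  rwa [h.graphNormal_zero, h.norm_eq, inv_one, one_smul] at this

theorem gaussMap_graphMap (h : C.IsGraphAt p u f) : ∀ᶠ y in 𝓝 0,
    C.gaussMap (graphMap p u f y) = ‖graphNormal u f y‖⁻¹ • graphNormal u f y := by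
  filter_upwards [h.eventually_eq_of_isUnitOuterNormal, h.graphMap_mem] with y h1 h2
  exact h1 _ (Classical.epsilon_spec (exists_isUnitOuterNormal h.interior_nonempty h2))

theorem gaussMap_eq (h : C.IsGraphAt p u f) : C.gaussMap p = u :=
  h.eq_of_isUnitOuterNormal (Classical.epsilon_spec ⟨u, h.normal⟩)

theorem hasFDerivAt_fderiv (h : C.IsGraphAt p u f) :
    HasFDerivAt (fderiv ℝ f) (fderiv ℝ (fderiv ℝ f) 0) 0 :=
  ((h.contDiffAt.fderiv_right (m := 1) (by norm_num)).differentiableAt one_ne_zero).hasFDerivAt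

/-- Support at `y` tested on `p`, and at `p` tested on `y`, give `Df(y) y ≥ f(y) ≥ 0`; put `y = t
w`, divide by `t²` and let `t → 0`. -/
theorem fderiv_fderiv_nonneg (h : C.IsGraphAt p u f) (w : (ℝ ∙ u)ᗮ) :
    0 ≤ fderiv ℝ (fderiv ℝ f) 0 w w := by
  have h1 : ∀ᶠ y in 𝓝 0, 0 ≤ fderiv ℝ f y y := by
    filter_upwards [h.eventually_inner_graphNormal_nonpos, h.graphMap_mem] with y h1 h2
    have h3 := h1 p (C.isClosed.frontier_subset h.mem_frontier)
    have h4 := h.normal.2 _ (C.isClosed.frontier_subset h2)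
    rw [inner_graphMap h.norm_eq] at h4
    have h5 : p - graphMap p u f y = ((-y : (ℝ ∙ u)ᗮ) : EuclideanSpace ℝ (Fin n)) + f y • u := by
      rw [← neg_sub, graphMap_sub, Submodule.coe_neg]; abel
    rw [h5, inner_graphNormal h.norm_eq, map_neg] at h3
    linarith
  have hl : HasDerivAt (fun t : ℝ => t • w) w 0 := by
    simpa using (hasDerivAt_id (0 : ℝ)).smul_const w
  have h2 : HasDerivAt (fun t : ℝ => fderiv ℝ f (t • w) w) (fderiv ℝ (fderiv ℝ f) 0 w w) 0 := by
    have h3 : HasDerivAt (fun t : ℝ => fderiv ℝ f (t • w)) (fderiv ℝ (fderiv ℝ f) 0 w) 0 :=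
      HasFDerivAt.comp_hasDerivAt (l := fderiv ℝ f) 0
        (by simpa using h.hasFDerivAt_fderiv) hl
    simpa using h3.clm_apply (hasDerivAt_const 0 w)
  refine ge_of_tendsto h2.tendsto_slope_zero ?_
  have h3 : Tendsto (fun t : ℝ => t • w) (𝓝 0) (𝓝 0) := by simpa using hl.continuousAt.tendsto
  filter_upwards [(h3.eventually h1).filter_mono nhdsWithin_le_nhds, self_mem_nhdsWithin]
    with t ht ht0
  have ht0' : t ≠ 0 := ht0
  rw [map_smul, smul_eq_mul] at ht
  have h4 : t⁻¹ * fderiv ℝ f (t • w) w = (t⁻¹) ^ 2 * (t * fderiv ℝ f (t • w) w) := by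
    field_simp
  simp only [zero_add, zero_smul, h.fderiv_zero, _root_.zero_apply, sub_zero,
    smul_eq_mul]
  rw [h4]
  positivity

theorem isCHolderNear_iff (h : C.IsGraphAt p u f) {k : WithTop ℕ∞} {α : ℝ≥0} (hα : α ≤ 1)
    (hk : 1 ≤ k) : C.IsCHolderNear k α p ↔ CHolderNear k α f 0 := by
  refine ⟨fun hC => ?_, fun hf => h.isGraphNear.isCHolderNear hα h.norm_eq hf⟩
  obtain ⟨g, hg0, hg, hgC⟩ := exists_isGraphNear_of_isCHolderNear hα hk hC h.mem_frontier h.normal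
  exact hg.congr (hgC.unique h.norm_eq hg0 hg.contDiffAt.continuousAt h.isGraphNear)

theorem isCHolderNear_of_le_one (h : C.IsGraphAt p u f) {k : WithTop ℕ∞} {α : ℝ≥0} (hα : α ≤ 1)
    (hk : k ≤ 1) : C.IsCHolderNear k α p :=
  h.isGraphNear.isCHolderNear hα h.norm_eq (.of_contDiffAt_two hα hk h.contDiffAt)

theorem exists_of_isCHolderNear (hC : C.IsCHolderNear 2 0 p)
    (hp : p ∈ frontier (C : Set (EuclideanSpace ℝ (Fin n)))) (hu : C.IsUnitOuterNormal p u)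
    (hint : (interior (C : Set (EuclideanSpace ℝ (Fin n)))).Nonempty) :
    ∃ f, C.IsGraphAt p u f := by
  obtain ⟨f, hf0, hf, hfC⟩ :=
    exists_isGraphNear_of_isCHolderNear zero_le_one one_le_two hC hp hu
  exact ⟨f, hu, hint, hf.contDiffAt, hf0, hfC⟩

theorem hasFDerivAt_unitNormal (h : C.IsGraphAt p u f) :
    HasFDerivAt (fun y => ‖graphNormal u f y‖⁻¹ • graphNormal u f y)
      ((ℝ ∙ u)ᗮ.subtypeL ∘L rieszRep (ℝ ∙ u)ᗮ ∘L fderiv ℝ (fderiv ℝ f) 0) 0 := by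
  have h1 : HasFDerivAt (fun y => rieszRep (ℝ ∙ u)ᗮ (fderiv ℝ f y))
      (rieszRep (ℝ ∙ u)ᗮ ∘L fderiv ℝ (fderiv ℝ f) 0) 0 :=
    (rieszRep (ℝ ∙ u)ᗮ).hasFDerivAt.comp 0 h.hasFDerivAt_fderiv
  have hN : HasFDerivAt (graphNormal u f)
      ((ℝ ∙ u)ᗮ.subtypeL ∘L rieszRep (ℝ ∙ u)ᗮ ∘L fderiv ℝ (fderiv ℝ f) 0) 0 :=
    ((ℝ ∙ u)ᗮ.subtypeL.hasFDerivAt.comp 0 h1).const_add u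
  -- The squared norm is `1 + ‖∇f‖²` with `∇f(0) = 0`, so normalizing does not change the first
  -- derivative at 0.
  have h2 : HasFDerivAt (fun y => ‖graphNormal u f y‖⁻¹) (0 : (ℝ ∙ u)ᗮ →L[ℝ] ℝ) 0 := by
    have h3 : HasFDerivAt (fun y => 1 + ‖rieszRep (ℝ ∙ u)ᗮ (fderiv ℝ f y)‖ ^ 2)
        (0 : (ℝ ∙ u)ᗮ →L[ℝ] ℝ) 0 := by
      have h4 := h1.norm_sq.const_add 1
      simpa [h.fderiv_zero] using h4
    have h5 : HasDerivAt (fun r : ℝ => (√r)⁻¹) (-(1 / (2 * √1)) / √1 ^ 2) 1 :=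
      (Real.hasDerivAt_sqrt one_ne_zero).fun_inv (by simp)
    have h6 := HasDerivAt.comp_hasFDerivAt
      (h₂ := fun r : ℝ => (√r)⁻¹) 0 (by simpa [h.fderiv_zero] using h5) h3
    rw [smul_zero] at h6
    refine h6.congr_of_eventuallyEq (.of_forall fun y => ?_)
    simp only [Function.comp_apply]
    rw [← norm_sq_graphNormal h.norm_eq, Real.sqrt_sq (norm_nonneg _)]
  exact (h2.smul hN).congr_fderiv (by simp [h.graphNormal_zero, h.norm_eq])

theorem hasFDerivAt_graphMap (h : C.IsGraphAt p u f) :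
    HasFDerivAt (graphMap p u f) (ℝ ∙ u)ᗮ.subtypeL 0 := by
  have h1 : HasFDerivAt f (0 : (ℝ ∙ u)ᗮ →L[ℝ] ℝ) 0 := by
    rw [← h.fderiv_zero]
    exact (h.contDiffAt.differentiableAt two_ne_zero).hasFDerivAt
  exact (((ℝ ∙ u)ᗮ.subtypeL.hasFDerivAt.const_add p).sub (h1.smul_const u)).congr_fderiv (by simp)

/-- On the boundary the Gauss map factors through the projection to `uᗮ`. This ensures that
`fderivWithin` is a true derivative and not its default value. -/
theorem differentiableWithinAt_gaussMap (h : C.IsGraphAt p u f) :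
    DifferentiableWithinAt ℝ C.gaussMap (frontier (C : Set (EuclideanSpace ℝ (Fin n)))) p := by
  set ν : (ℝ ∙ u)ᗮ → EuclideanSpace ℝ (Fin n) :=
    fun y => ‖graphNormal u f y‖⁻¹ • graphNormal u f y with hν
  have hev : ∀ᶠ x in 𝓝[frontier (C : Set (EuclideanSpace ℝ (Fin n)))] p,
      C.gaussMap x = (ν ∘ fun x => (ℝ ∙ u)ᗮ.orthogonalProjectionOnto (x - p)) x := by
    filter_upwards [h.isGraphNear.filter_mono nhdsWithin_le_nhds, self_mem_nhdsWithin,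
      (tendsto_projection.eventually h.gaussMap_graphMap).filter_mono nhdsWithin_le_nhds]
      with x h1 h2 h3
    have h4 := eq_graphMap_sub (p := p) (f := f) h.norm_eq x
    rw [h1.1 h2, zero_smul, add_zero] at h4
    rw [Function.comp_apply, hν]
    beta_reduce
    rw [← h3, ← h4]
  have h1 : DifferentiableAt ℝ (ν ∘ fun x => (ℝ ∙ u)ᗮ.orthogonalProjectionOnto (x - p)) p := by
    refine DifferentiableAt.comp p ?_
      ((ℝ ∙ u)ᗮ.orthogonalProjectionOnto.differentiableAt.comp p (by fun_prop))
    rw [sub_self, _root_.map_zero]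
    exact h.hasFDerivAt_unitNormal.differentiableAt
  exact h1.differentiableWithinAt.congr_of_eventuallyEq hev (hev.self_of_nhdsWithin h.mem_frontier)

/-- Both sides differentiate the Gauss map along the graph parametrization. Comparing on the full
space `uᗮ` avoids the non-uniqueness of derivatives within a hypersurface. -/
theorem fderivWithin_gaussMap_comp (h : C.IsGraphAt p u f) :
    fderivWithin ℝ C.gaussMap (frontier (C : Set (EuclideanSpace ℝ (Fin n)))) p ∘L
      (ℝ ∙ u)ᗮ.subtypeL =
      (ℝ ∙ u)ᗮ.subtypeL ∘L rieszRep (ℝ ∙ u)ᗮ ∘L fderiv ℝ (fderiv ℝ f) 0 := by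
  refine HasFDerivAt.unique (f := C.gaussMap ∘ graphMap p u f) (x := 0) ?_
    (h.hasFDerivAt_unitNormal.congr_of_eventuallyEq h.gaussMap_graphMap)
  rw [← hasFDerivWithinAt_univ]
  refine HasFDerivWithinAt.comp_of_tendsto
    (t := frontier (C : Set (EuclideanSpace ℝ (Fin n)))) 0 ?_
    h.hasFDerivAt_graphMap.hasFDerivWithinAt ?_
  · rw [graphMap_zero h.map_zero]
    exact h.differentiableWithinAt_gaussMap.hasFDerivWithinAt
  · rw [graphMap_zero h.map_zero, nhdsWithin_univ]
    exact tendsto_nhdsWithin_iff.2 ⟨h.tendsto_graphMap, h.graphMap_mem⟩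

theorem gaussianCurvature_ne_zero_iff (h : C.IsGraphAt p u f) :
    C.gaussianCurvature p ≠ 0 ↔ Function.Injective (fderiv ℝ (fderiv ℝ f) 0) := by
  -- Makes the tangent hyperplane literally the domain of `f`.
  obtain rfl := h.gaussMap_eq
  have hdiff : C.gaussMapDifferential p =
      (rieszRep (ℝ ∙ C.gaussMap p)ᗮ ∘L fderiv ℝ (fderiv ℝ f) 0 :
        (ℝ ∙ C.gaussMap p)ᗮ →L[ℝ] (ℝ ∙ C.gaussMap p)ᗮ).toLinearMap := by
    ext1 w
    change (ℝ ∙ C.gaussMap p)ᗮ.orthogonalProjectionOnto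
      ((fderivWithin ℝ C.gaussMap (frontier (C : Set (EuclideanSpace ℝ (Fin n)))) p ∘L
        (ℝ ∙ C.gaussMap p)ᗮ.subtypeL) w) = _
    rw [h.fderivWithin_gaussMap_comp]
    exact Submodule.orthogonalProjectionOnto_mem_subspace_eq_self _
  rw [gaussianCurvature, hdiff, ← isUnit_iff_ne_zero]
  refine (LinearMap.isUnit_iff_isUnit_det (R := ℝ) (M := (ℝ ∙ C.gaussMap p)ᗮ) _).symm.trans ?_
  rw [LinearMap.isUnit_iff_ker_eq_bot, LinearMap.ker_eq_bot]
  exact Function.Injective.of_comp_iff (rieszRep_injective (V := (ℝ ∙ C.gaussMap p)ᗮ))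
    (fderiv ℝ (fderiv ℝ f) 0)

end ConvexBody.IsGraphAt

end Bodies

/-! ### The boundary of a Minkowski sum as a graph. -/

section MinkowskiSum

variable {n : ℕ} {A B : ConvexBody (EuclideanSpace ℝ (Fin n))}
  {a b u : EuclideanSpace ℝ (Fin n)}

namespace ConvexBody

theorem mem_add_of_mem (ha : a ∈ A) (hb : b ∈ B) : a + b ∈ A + B := by
  change a + b ∈ ((A + B : ConvexBody (EuclideanSpace ℝ (Fin n))) : Set _)
  rw [coe_add]
  exact Set.add_mem_add ha hb

theorem interior_add_nonempty (hA : (interior (A : Set (EuclideanSpace ℝ (Fin n)))).Nonempty)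
    (hb : b ∈ B) :
    (interior ((A + B : ConvexBody (EuclideanSpace ℝ (Fin n))) :
      Set (EuclideanSpace ℝ (Fin n)))).Nonempty := by
  rw [coe_add]
  obtain ⟨q, hq⟩ := hA
  exact ⟨q + b, interior_maximal (Set.add_subset_add_right interior_subset)
    isOpen_interior.add_right (Set.add_mem_add hq hb)⟩

theorem IsUnitOuterNormal.left_of_add (hb : b ∈ B) (h : (A + B).IsUnitOuterNormal (a + b) u) :
    A.IsUnitOuterNormal a u :=
  ⟨h.1, fun x hx => by simpa using h.2 _ (mem_add_of_mem hx hb)⟩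

theorem IsUnitOuterNormal.right_of_add (ha : a ∈ A) (h : (A + B).IsUnitOuterNormal (a + b) u) :
    B.IsUnitOuterNormal b u :=
  ⟨h.1, fun x hx => by simpa using h.2 _ (mem_add_of_mem ha hx)⟩

theorem inner_add_nonpos {v : EuclideanSpace ℝ (Fin n)} (hA : ∀ x ∈ A, inner ℝ v (x - a) ≤ 0)
    (hB : ∀ x ∈ B, inner ℝ v (x - b) ≤ 0) : ∀ x ∈ A + B, inner ℝ v (x - (a + b)) ≤ 0 := by
  intro x hx
  replace hx : x ∈ ((A + B : ConvexBody (EuclideanSpace ℝ (Fin n))) : Set _) := hx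
  rw [coe_add] at hx
  obtain ⟨y, hy, z, hz, rfl⟩ := hx
  rw [add_sub_add_comm, inner_add_right]
  exact add_nonpos (hA y hy) (hB z hz)

/-- Equal gradients mean equal graph normals, so the sum of the two graph points is supported and
nothing of `A + B` lies above it. Points just below are interior by convexity. -/
theorem IsGraphAt.add {f g : (ℝ ∙ u)ᗮ → ℝ} (hA : A.IsGraphAt a u f) (hB : B.IsGraphAt b u g)
    {Y : (ℝ ∙ u)ᗮ → (ℝ ∙ u)ᗮ} (hY0 : Y 0 = 0) (hY : ContinuousAt Y 0)
    (hfg : ∀ᶠ z in 𝓝 0, fderiv ℝ f (z - Y z) = fderiv ℝ g (Y z))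
    (hh : ContDiffAt ℝ 2 (fun z => f (z - Y z) + g (Y z)) 0) :
    (A + B).IsGraphAt (a + b) u (fun z => f (z - Y z) + g (Y z)) := by
  have haA := A.isClosed.frontier_subset hA.mem_frontier
  have hbB := B.isClosed.frontier_subset hB.mem_frontier
  have hint := interior_add_nonempty hA.interior_nonempty hbB
  set h : (ℝ ∙ u)ᗮ → ℝ := fun z => f (z - Y z) + g (Y z) with hdef
  have hu := hA.norm_eq
  have h0 : h 0 = 0 := by simp [hdef, hY0, hA.map_zero, hB.map_zero]
  refine ⟨⟨hu, inner_add_nonpos hA.normal.2 hB.normal.2⟩, hint, hh, h0, ?_⟩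
  have hYt : Tendsto Y (𝓝 0) (𝓝 0) := by simpa [ContinuousAt, hY0] using hY
  have hXt : Tendsto (fun z => z - Y z) (𝓝 0) (𝓝 0) := by simpa using tendsto_id.sub hYt
  have hadd : ∀ z, graphMap a u f (z - Y z) + graphMap b u g (Y z) = graphMap (a + b) u h z := by
    intro z
    simp only [graphMap, hdef, Submodule.coe_sub]
    module
  have hmem : ∀ᶠ z in 𝓝 0, graphMap (a + b) u h z ∈ A + B := by
    filter_upwards [hXt.eventually hA.graphMap_mem, hYt.eventually hB.graphMap_mem] with z h1 h2
    rw [← hadd]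
    exact mem_add_of_mem (A.isClosed.frontier_subset h1) (B.isClosed.frontier_subset h2)
  have hnorm : ∀ᶠ z in 𝓝 0, ∀ x ∈ A + B,
      inner ℝ (graphNormal u g (Y z)) (x - graphMap (a + b) u h z) ≤ 0 := by
    filter_upwards [hXt.eventually hA.eventually_inner_graphNormal_nonpos,
      hYt.eventually hB.eventually_inner_graphNormal_nonpos, hfg] with z h1 h2 h3
    rw [← hadd]
    refine inner_add_nonpos ?_ h2
    rwa [graphNormal, h3, ← graphNormal] at h1
  -- Uniqueness of the normal of `A + B` at `a + b` is inherited from `A`.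
  obtain ⟨t, ht, htint⟩ := exists_sub_smul_mem_interior hint (mem_add_of_mem haA hbB)
    fun v hv => hA.eq_of_isUnitOuterNormal (hv.left_of_add hbB)
  have hgm : Tendsto (graphMap (a + b) u h) (𝓝 0) (𝓝 (a + b)) :=
    _root_.tendsto_graphMap h0 hh.continuousAt
  have hbelow : ∀ᶠ z in 𝓝 0, graphMap (a + b) u h z - t • u ∈
      interior ((A + B : ConvexBody (EuclideanSpace ℝ (Fin n))) :
        Set (EuclideanSpace ℝ (Fin n))) :=
    (hgm.sub_const _).eventually (isOpen_interior.mem_nhds htint)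
  have hproj := tendsto_projection (p := a + b) (u := u)
  have hs : ∀ᶠ x in 𝓝 (a + b),
      -t < inner ℝ u (x - (a + b)) + h ((ℝ ∙ u)ᗮ.orthogonalProjectionOnto (x - (a + b))) := by
    have h1 : Tendsto (fun x => inner ℝ u (x - (a + b)) +
        h ((ℝ ∙ u)ᗮ.orthogonalProjectionOnto (x - (a + b)))) (𝓝 (a + b)) (𝓝 (0 + 0)) := by
      refine Tendsto.add ?_ ?_
      · have : Continuous fun x => inner ℝ u (x - (a + b)) := by fun_prop
        simpa using this.tendsto (a + b)
      · have := hh.continuousAt.tendsto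
        rw [h0] at this
        exact this.comp hproj
    exact h1.eventually (lt_mem_nhds (by linarith))
  filter_upwards [hproj.eventually hmem, hproj.eventually hnorm, hproj.eventually hbelow, hs]
    with x h1 h2 h3 h4
  have hx := eq_graphMap_sub (p := a + b) (f := h) hu x
  set z := (ℝ ∙ u)ᗮ.orthogonalProjectionOnto (x - (a + b))
  set s := inner ℝ u (x - (a + b)) + h z
  rw [(A + B).isClosed.frontier_eq]
  constructor
  · rintro ⟨hxm, hxi⟩
    have h5 := h2 x hxm
    have h6 := inner_graphNormal hu g (Y z) 0 s
    have h7 : x - graphMap (a + b) u h z = s • u := by rw [hx]; abel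
    rw [Submodule.coe_zero, zero_add, _root_.map_zero, zero_add] at h6
    rw [h7, h6] at h5
    refine h5.eq_of_not_lt fun hs0 => hxi ?_
    -- For height `-t < s < 0`, `x` divides the segment from the interior point at depth `t` to the
    -- graph point with weights `-s / t` and `1 + s / t`.
    have h8 := (A + B).convex.combo_interior_self_mem_interior h3 h1 (a := -s / t) (b := 1 + s / t)
      (div_pos (by linarith) ht) (by rw [← div_self ht.ne', ← add_div]; apply div_nonneg <;> linarith)
      (by ring)
    convert h8 using 1
    rw [hx]
    have h9 : s = (s / t) * t := by field_simp
    nth_rewrite 1 [h9]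
    module
  · intro hs0
    rw [hs0, zero_smul, add_zero] at hx
    rw [hx]
    refine ⟨h1, fun hi => ?_⟩
    have := inner_lt_of_mem_interior (graphNormal_ne_zero hu g (Y z)) h2 hi
    simp at this

end ConvexBody

end MinkowskiSum

/-! ### The theorem for a pair of bodies. -/

theorem theorem1p1 (n : ℕ) (k : WithTop ℕ∞) (α : ℝ≥0) (hα : α ≤ 1)
    (A B : ConvexBody (EuclideanSpace ℝ (Fin n)))
    (hAint : (interior (A : Set (EuclideanSpace ℝ (Fin n)))).Nonempty)
    (hBint : (interior (B : Set (EuclideanSpace ℝ (Fin n)))).Nonempty)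
    (hA : A.IsCHolder 2 0) (hB : B.IsCHolder 2 0)
    (a b : EuclideanSpace ℝ (Fin n))
    (ha : a ∈ frontier (A : Set (EuclideanSpace ℝ (Fin n))))
    (hb : b ∈ frontier (B : Set (EuclideanSpace ℝ (Fin n))))
    (hab : a + b ∈ frontier ((A + B : ConvexBody (EuclideanSpace ℝ (Fin n))) :
      Set (EuclideanSpace ℝ (Fin n))))
    (hAk : A.IsCHolderNear k α a) (hGA : A.gaussianCurvature a ≠ 0) :
    (A + B).IsCHolderNear 2 0 (a + b) ∧
    (B.gaussianCurvature b ≠ 0 ↔ (A + B).gaussianCurvature (a + b) ≠ 0) ∧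
    (B.IsCHolderNear k α b ↔ (A + B).IsCHolderNear k α (a + b)) := by
  have haA := A.isClosed.frontier_subset ha
  have hbB := B.isClosed.frontier_subset hb
  obtain ⟨u, hu⟩ := ConvexBody.exists_isUnitOuterNormal
    (ConvexBody.interior_add_nonempty hAint hbB) hab
  obtain ⟨f, hf⟩ := ConvexBody.IsGraphAt.exists_of_isCHolderNear
    ⟨Set.univ, isOpen_univ, Set.mem_univ a, by simpa [ConvexBody.IsCHolder] using hA⟩ ha (hu.left_of_add hbB) hAint
  obtain ⟨g, hg⟩ := ConvexBody.IsGraphAt.exists_of_isCHolderNear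
    ⟨Set.univ, isOpen_univ, Set.mem_univ b, by simpa [ConvexBody.IsCHolder] using hB⟩ hb (hu.right_of_add haA) hBint
  -- Injectivity of the Hessian and equality of dimensions with the dual give the isomorphism `H`.
  have hinj := hf.gaussianCurvature_ne_zero_iff.1 hGA
  have hrank : Module.finrank ℝ (ℝ ∙ u)ᗮ = Module.finrank ℝ ((ℝ ∙ u)ᗮ →L[ℝ] ℝ) :=
    ((LinearMap.toContinuousLinearMap (𝕜 := ℝ) (E := (ℝ ∙ u)ᗮ) (F' := ℝ)).finrank_eq.symm.trans
      Subspace.dual_finrank_eq).symm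
  set H : (ℝ ∙ u)ᗮ ≃L[ℝ] ((ℝ ∙ u)ᗮ →L[ℝ] ℝ) :=
    (LinearEquiv.ofInjectiveOfFinrankEq (fderiv ℝ (fderiv ℝ f) 0).toLinearMap hinj
      hrank).toContinuousLinearEquiv
  obtain ⟨Y, hY0, hY, hfg, hh, -, hcurv, hreg⟩ := exists_splitting hf.cHolderNear hg.cHolderNear
    hf.fderiv_zero hg.fderiv_zero (A := H) hf.hasFDerivAt_fderiv hf.fderiv_fderiv_nonneg
    hg.fderiv_fderiv_nonneg
  have hsum := hf.add hg hY0 hY hfg hh.contDiffAt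
  refine ⟨(hsum.isCHolderNear_iff zero_le_one one_le_two).2 hh, ?_, ?_⟩
  · rw [hg.gaussianCurvature_ne_zero_iff, hsum.gaussianCurvature_ne_zero_iff, hcurv]
  -- For `k ≤ 1` both sides hold automatically, since `C^2` graph functions are `C^{k,α}` for all `α
  -- ≤ 1`.
  · by_cases hk : 2 ≤ k
    · have hk1 := one_le_two.trans hk
      rw [hg.isCHolderNear_iff hα hk1, hsum.isCHolderNear_iff hα hk1]
      exact hreg k α hk hα ((hf.isCHolderNear_iff hα hk1).1 hAk)
    · have hk1 : k ≤ 1 := by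
        match k, hk with
        | ⊤, hk => exact absurd le_top hk
        | ((⊤ : ℕ∞) : WithTop ℕ∞), hk => exact absurd (by norm_cast) hk
        | ((m : ℕ) : WithTop ℕ∞), hk =>
          have : ¬ 2 ≤ m := fun h => hk (by exact_mod_cast h)
          exact_mod_cast (by omega : m ≤ 1)
      exact iff_of_true (hg.isCHolderNear_of_le_one hα hk1) (hsum.isCHolderNear_of_le_one hα hk1)
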